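/- **Theorem (Phased GP Uncertainty Sampling).** *Setting.* Let $\mathcal D\subset\mathbb R^d$ be non-empty and compact, let $k:\mathcal D\times\mathcal D\to\mathbb R$ be a positive (semi-)definite measurable kernel with $k(x,x)\le 1$ for all $x$, which is not identically zero on the diagonal, and let $\mathcal H_k$ be its reproducing kernel Hilbert space with norm $\|\cdot\|_k$. Let $B>0$ and $\epsilon\ge 0$, let $f^*:\mathcal D\to\mathbb R$, and let $f\in\mathcal H_k$ satisfy $\|f\|_k\le B$ and $\|f-f^*\|_\infty\le\epsilon$. When the learner plays $x_t\in\mathcal D$ in round $t$, it observes $y_t=f^*(x_t)+\eta_t$, where $\eta_t$ is $\sigma$-sub-Gaussian, and $\eta_t$ is independent of everything that precedes it, $x_t$ included. Fix $\lambda>0$ and put, for points $x_1,\dots,x_n$ and observations $Y_n=(y_1,\dots,y_n)$, $K_n=[k(x_i,x_j)]_{i,j\le n}$, $k_n(x)=[k(x_i,x)]_{i\le n}$, $$\mu_n(x)=k_n(x)^T(K_n+\lambda I)^{-1}Y_n,\qquad \sigma_n^2(x)=k(x,x)-k_n(x)^T(K_n+\lambda I)^{-1}k_n(x),$$ $$\beta_{n+1}(\delta')=\tfrac{\sigma}{\sqrt\lambda}\Big(2\ln\tfrac1{\delta'}+\sum_{i=1}^{n}\ln\big(1+\lambda^{-1}\sigma_{i-1}^2(x_i)\big)\Big)^{1/2}+B,$$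 $$\gamma_n=\sup_{(x_1,\dots,x_n)\in\mathcal D^n}\tfrac12\ln\det(I+\lambda^{-1}K_n).$$ *Algorithm.* Let $T\ge1$, $\delta\in(0,1)$ and let $E=\lfloor\log_2T\rfloor+1$ be the number of episodes. Episode $e=1,2,\dots$ has length $m_e=2^{e-1}$, and $\mathcal D_1=\mathcal D$. At the beginning of each episode the model is reset, and round $t=1,\dots,m_e$ of the episode plays some $x_t\in\arg\max_{x\in\mathcal D_e}\sigma^2_{t-1}(x)$ (ties broken arbitrarily, without looking at future noise), where $\sigma_{t-1}$ is computed from the points of this episode only. After the episode, $\mu_{m_e}$ is computed from the observations of the episode and, with $\beta_{m_e+1}=\beta_{m_e+1}(\delta/E)$, $$\mathcal D_{e+1}=\Big\{x\in\mathcal D_e:\ \mu_{m_e}(x)+\beta_{m_e+1}\sigma_{m_e}(x)\ \ge\ \max_{x'\in\mathcal D_e}\big(\mu_{m_e}(x')-\beta_{m_e+1}\sigma_{m_e}(x')\big)\Big\}.$$ The algorithm stops after $T$ rounds in total; it does not use $\epsilon$. (The maxima that it uses are assumed to be attained.) *Claim.* There are an absolute $p\in\mathbb N$ and, for all $\lambda>0$,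 $\sigma\ge0$, $\kappa>0$, a constant $C=C(\lambda,\sigma,\kappa)$, such that in the above setting, whenever $k(x,x)\ge\kappa$ for some $x\in\mathcal D$, with probability at least $1-\delta$ both of the following hold. 1. The regret $R_T^*=\sum_{t=1}^T\big(\sup_{x\in\mathcal D}f^*(x)-f^*(x_t)\big)$, where $x_1,\dots,x_T$ are the actions of all $T$ rounds, satisfies $$R_T^*\le C(1+\ln T)^p\Big(B\sqrt{\gamma_TT}+\sqrt{(\ln(1/\delta)+\gamma_T)\gamma_TT}+\epsilon T\sqrt{\gamma_T}\Big).$$ 2. A near-optimal action survives each elimination step: for every episode $e$ that is followed by another round, and every $x\in\mathcal D_e$, there is $\hat x\in\mathcal D_{e+1}$ with $f(x)-f(\hat x)\le2\epsilon\sqrt{(2+\lambda^{-1})\gamma_{m_e}}$. In particular, for $\epsilon=0$ the regret is at most $C(1+\ln T)^p\big(B\sqrt{\gamma_TT}+\sqrt{(\ln(1/\delta)+\gamma_T)\gamma_TT}\big)$, the standard rate up to polylogarithmic factors. -/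

import Mathlib

open MeasureTheory ProbabilityTheory

noncomputable section

namespace PhasedGP

variable {X : Type*}

/-- The kernel matrix `K_n = [k(x_i, x_j)]` of the first `n` points of the sequence `x`. -/
def kernelMatrix (k : X → X → ℝ) (x : ℕ → X) (n : ℕ) : Matrix (Fin n) (Fin n) ℝ :=
  Matrix.of fun i j => k (x i) (x j)

/-- The vector `k_n(z) = [k(x_1, z), …, k(x_n, z)]`. -/
def kernelVec (k : X → X → ℝ) (x : ℕ → X) (n : ℕ) (z : X) : Fin n → ℝ :=
  fun i => k (x i) z

/-- GP posterior mean `k_n(z)ᵀ (K_n + λ I)⁻¹ Y_n` after the first `n` points of `x` have been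
queried, with observations the first `n` entries of `y`. -/
def postMean (k : X → X → ℝ) (lam : ℝ) (x : ℕ → X) (y : ℕ → ℝ) (n : ℕ) (z : X) : ℝ :=
  kernelVec k x n z ⬝ᵥ
    Matrix.mulVec (kernelMatrix k x n + lam • (1 : Matrix (Fin n) (Fin n) ℝ))⁻¹
      (fun i : Fin n => y i)

/-- GP posterior variance `σ²_n(z) = k(z,z) - k_n(z)ᵀ (K_n + λ I)⁻¹ k_n(z)`. -/
def postVar (k : X → X → ℝ) (lam : ℝ) (x : ℕ → X) (n : ℕ) (z : X) : ℝ :=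
  k z z - kernelVec k x n z ⬝ᵥ
    Matrix.mulVec (kernelMatrix k x n + lam • (1 : Matrix (Fin n) (Fin n) ℝ))⁻¹
      (kernelVec k x n z)

/-- GP posterior standard deviation `σ_n(z)`. -/
def postStd (k : X → X → ℝ) (lam : ℝ) (x : ℕ → X) (n : ℕ) (z : X) : ℝ :=
  Real.sqrt (postVar k lam x n z)

/-- Maximum information gain `γ_n = max ½ ln det (I + λ⁻¹ K_n)` over all choices of `n` points
(repetitions allowed). -/
def infoGain (k : X → X → ℝ) (lam : ℝ) (n : ℕ) : ℝ :=
  ⨆ s : Fin n → X,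
    (1 / 2) * Real.log (Matrix.det
      ((1 : Matrix (Fin n) (Fin n) ℝ) + lam⁻¹ • Matrix.of fun i j => k (s i) (s j)))

/-- The confidence parameter
`β_{n+1} = (σ/√λ) √(2 ln (1/δ) + ∑_{i ≤ n} ln (1 + λ⁻¹ σ²_{i-1}(x_i))) + B` of the realizable
setting, at confidence level `δ`, for the first `n` points of `x`. -/
def confBeta (k : X → X → ℝ) (lam sigma B delta : ℝ) (x : ℕ → X) (n : ℕ) : ℝ :=
  sigma / Real.sqrt lam *
    Real.sqrt (2 * Real.log (1 / delta)
      + ∑ i ∈ Finset.range n, Real.log (1 + lam⁻¹ * postVar k lam x i (x i))) + B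

/-- The part of a sequence of rounds that belongs to episode `e`. Rounds and episodes are counted
from `0`; episode `e` has `2 ^ e` rounds, the first of which is round `2 ^ e - 1`. -/
def episode {α : Type*} (u : ℕ → α) (e : ℕ) : ℕ → α :=
  fun s => u (2 ^ e - 1 + s)

/-- Hallucinated upper confidence bound at the end of episode `e` (the model only uses the data of
episode `e`). -/
def ucb (k : X → X → ℝ) (lam sigma B delta : ℝ) (x : ℕ → X) (y : ℕ → ℝ) (e : ℕ) (z : X) : ℝ :=
  postMean k lam (episode x e) (episode y e) (2 ^ e) z
    + confBeta k lam sigma B delta (episode x e) (2 ^ e) * postStd k lam (episode x e) (2 ^ e) z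

/-- Hallucinated lower confidence bound at the end of episode `e`. -/
def lcb (k : X → X → ℝ) (lam sigma B delta : ℝ) (x : ℕ → X) (y : ℕ → ℝ) (e : ℕ) (z : X) : ℝ :=
  postMean k lam (episode x e) (episode y e) (2 ^ e) z
    - confBeta k lam sigma B delta (episode x e) (2 ^ e) * postStd k lam (episode x e) (2 ^ e) z

/-- The set of actions that are still active in episode `e`. At the end of an episode, the actions
retained are those whose upper confidence bound is at least the maximum, over the active actions,
of the lower confidence bound. -/
def active (k : X → X → ℝ) (lam sigma B delta : ℝ) (x : ℕ → X) (y : ℕ → ℝ) : ℕ → Set X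
  | 0 => Set.univ
  | e + 1 =>
    {z | z ∈ active k lam sigma B delta x y e ∧
      ∃ w ∈ active k lam sigma B delta x y e,
        IsMaxOn (lcb k lam sigma B delta x y e) (active k lam sigma B delta x y e) w ∧
        lcb k lam sigma B delta x y e w ≤ ucb k lam sigma B delta x y e z}

/-- `x` (actions) and `y` (observations) form the first `T` rounds of a run of Phased GP Uncertainty
Sampling: in round `s` of episode `e` the action is an active one of maximal posterior variance,
given the `s` actions already chosen in that episode; ties are broken arbitrarily. -/
def IsRun (k : X → X → ℝ) (lam sigma B delta : ℝ) (T : ℕ) (x : ℕ → X) (y : ℕ → ℝ) : Prop :=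
  ∀ e s : ℕ, s < 2 ^ e → 2 ^ e - 1 + s < T →
    episode x e s ∈ active k lam sigma B delta x y e ∧
    IsMaxOn (postVar k lam (episode x e) s) (active k lam sigma B delta x y e) (episode x e s)

/-- The number of episodes (the last one possibly incomplete) among the first `T ≥ 1` rounds. -/
def numEpisodes (T : ℕ) : ℕ := Nat.log 2 T + 1

/-- Cumulative regret over the first `T` rounds. -/
def regret (fstar : X → ℝ) (T : ℕ) (x : ℕ → X) : ℝ :=
  ∑ t ∈ Finset.range T, ((⨆ z, fstar z) - fstar (x t))

end PhasedGP

end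

/-! Through a feature map `φ` with `k z w = ⟪φ z, φ w⟫`, the posterior variance is the minimum of a
ridge objective, so it can only fall as data arrive. After an episode of length n the posterior mean
at z errs by at most (β + ε√(n/λ)) σ_n(z): `B` pays for the bias, the rest of β for the noise, and
ε√(n/λ) for the misspecification (`abs_postMean_sub_le`). The intervals of the algorithm omit that
last term. This is harmless because uncertainty sampling forces σ_n ≤ √(λ/n) √((2 + λ⁻¹)γ_n) on all
active actions, and the powers of n cancel: one elimination step loses at most 2ε√((2 + λ⁻¹)γ_n)
(`exists_active_succ_sub_le`). These losses add up over logarithmically many episodes. Survivors of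
a step have close values (`sub_le_of_mem_active_succ`), so round t costs about β√(γ/t) plus the
accumulated misspecification, and summation gives `regret_le`.

Probability enters only through `measure_energy_gt_le`. The exponential of energy/(2σ²) minus half
the information sum has expectation at most one, by the rank-one update `energy_succ` and a Gaussian
average (`lintegral_exp_quadratic_le`). Markov's inequality and a union bound over episodes finish
the argument. -/

namespace PhasedGP

open scoped InnerProductSpace Matrix

/-! ### Kernel ridge regression in feature space -/

section Kernel

variable {X H : Type*} [NormedAddCommGroup H] [InnerProductSpace ℝ H]

/-- The regularized kernel matrix `K_n + λ I`. -/
noncomputable def regMatrix (k : X → X → ℝ) (lam : ℝ) (x : ℕ → X) (n : ℕ) :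
    Matrix (Fin n) (Fin n) ℝ :=
  kernelMatrix k x n + lam • (1 : Matrix (Fin n) (Fin n) ℝ)

/-- The weights `(K_n + λ I)⁻¹ k_n(z)` with which the observations enter the posterior mean
at `z`. -/
noncomputable def weights (k : X → X → ℝ) (lam : ℝ) (x : ℕ → X) (n : ℕ) (z : X) : Fin n → ℝ :=
  (regMatrix k lam x n)⁻¹ *ᵥ kernelVec k x n z

/-- The quadratic form `Yᵀ K_n (K_n + λ I)⁻¹ Y = Yᵀ Y - λ Yᵀ (K_n + λ I)⁻¹ Y`. -/
noncomputable def energy (k : X → X → ℝ) (lam : ℝ) (x : ℕ → X) (y : ℕ → ℝ) (n : ℕ) : ℝ :=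
  (∑ i : Fin n, y i ^ 2) -
    lam * ((fun i : Fin n => y i) ⬝ᵥ (regMatrix k lam x n)⁻¹ *ᵥ fun i : Fin n => y i)

variable {φ : X → H} {k : X → X → ℝ} {lam : ℝ}

lemma kernelMatrix_mulVec (hk : ∀ z w, k z w = ⟪φ z, φ w⟫_ℝ) (x : ℕ → X) (n : ℕ)
    (v : Fin n → ℝ) (i : Fin n) :
    (kernelMatrix k x n *ᵥ v) i = ⟪φ (x i), ∑ j, v j • φ (x j)⟫_ℝ := by
  simp [Matrix.mulVec, dotProduct, kernelMatrix, hk, inner_sum, inner_smul_right, mul_comm]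

lemma dotProduct_kernelMatrix_mulVec (hk : ∀ z w, k z w = ⟪φ z, φ w⟫_ℝ) (x : ℕ → X) (n : ℕ)
    (u v : Fin n → ℝ) :
    u ⬝ᵥ kernelMatrix k x n *ᵥ v = ⟪∑ j, u j • φ (x j), ∑ j, v j • φ (x j)⟫_ℝ := by
  simp only [dotProduct, kernelMatrix_mulVec hk, sum_inner, inner_smul_left]
  simp

lemma kernelVec_dotProduct (hk : ∀ z w, k z w = ⟪φ z, φ w⟫_ℝ) (x : ℕ → X) (n : ℕ) (z : X)
    (v : Fin n → ℝ) :
    kernelVec k x n z ⬝ᵥ v = ⟪φ z, ∑ j, v j • φ (x j)⟫_ℝ := by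
  simp [dotProduct, kernelVec, hk, inner_sum, inner_smul_right, mul_comm, real_inner_comm]

lemma regMatrix_mulVec (x : ℕ → X) (n : ℕ) (v : Fin n → ℝ) :
    regMatrix k lam x n *ᵥ v = kernelMatrix k x n *ᵥ v + lam • v := by
  simp [regMatrix, Matrix.add_mulVec, Matrix.smul_mulVec]

lemma regMatrix_transpose (hk : ∀ z w, k z w = ⟪φ z, φ w⟫_ℝ) (x : ℕ → X) (n : ℕ) :
    (regMatrix k lam x n)ᵀ = regMatrix k lam x n := by
  ext i j
  simp [regMatrix, kernelMatrix, hk, real_inner_comm, Matrix.one_apply, eq_comm]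

lemma regMatrix_posDef (hk : ∀ z w, k z w = ⟪φ z, φ w⟫_ℝ) (hlam : 0 < lam) (x : ℕ → X) (n : ℕ) :
    (regMatrix k lam x n).PosDef := by
  have h1 : (kernelMatrix k x n).PosSemidef := by
    have : kernelMatrix k x n = Matrix.gram ℝ (fun i : Fin n => φ (x i)) := by
      ext i j; simp [kernelMatrix, Matrix.gram_apply, hk]
    rw [this]; exact Matrix.posSemidef_gram ℝ _
  exact Matrix.PosDef.posSemidef_add h1 (Matrix.PosDef.one.smul hlam)

lemma isUnit_det_regMatrix (hk : ∀ z w, k z w = ⟪φ z, φ w⟫_ℝ) (hlam : 0 < lam) (x : ℕ → X)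
    (n : ℕ) : IsUnit (regMatrix k lam x n).det :=
  (regMatrix_posDef hk hlam x n).det_pos.ne'.isUnit

lemma dotProduct_inv_regMatrix_mulVec (hk : ∀ z w, k z w = ⟪φ z, φ w⟫_ℝ) (x : ℕ → X) (n : ℕ)
    (u v : Fin n → ℝ) :
    u ⬝ᵥ (regMatrix k lam x n)⁻¹ *ᵥ v = ((regMatrix k lam x n)⁻¹ *ᵥ u) ⬝ᵥ v := by
  rw [Matrix.dotProduct_mulVec, ← Matrix.mulVec_transpose, Matrix.transpose_nonsing_inv,
    regMatrix_transpose hk]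

lemma regMatrix_mulVec_inv (hk : ∀ z w, k z w = ⟪φ z, φ w⟫_ℝ) (hlam : 0 < lam) (x : ℕ → X)
    (n : ℕ) (v : Fin n → ℝ) :
    regMatrix k lam x n *ᵥ ((regMatrix k lam x n)⁻¹ *ᵥ v) = v := by
  rw [Matrix.mulVec_mulVec, Matrix.mul_nonsing_inv _ (isUnit_det_regMatrix hk hlam x n),
    Matrix.one_mulVec]

lemma inv_regMatrix_mulVec_eq (hk : ∀ z w, k z w = ⟪φ z, φ w⟫_ℝ) (hlam : 0 < lam) {x : ℕ → X}
    {n : ℕ} {u v : Fin n → ℝ} (h : regMatrix k lam x n *ᵥ u = v) :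
    (regMatrix k lam x n)⁻¹ *ᵥ v = u := by
  rw [← h, Matrix.mulVec_mulVec, Matrix.nonsing_inv_mul _ (isUnit_det_regMatrix hk hlam x n),
    Matrix.one_mulVec]

lemma postMean_eq_weights (hk : ∀ z w, k z w = ⟪φ z, φ w⟫_ℝ) (x : ℕ → X) (y : ℕ → ℝ)
    (n : ℕ) (z : X) :
    postMean k lam x y n z = ∑ i : Fin n, weights k lam x n z i * y i :=
  dotProduct_inv_regMatrix_mulVec hk x n _ _

/-- The objective of kernel ridge regression for `φ z`. -/
lemma ridge_objective_eq (hk : ∀ z w, k z w = ⟪φ z, φ w⟫_ℝ) (hlam : 0 < lam) (x : ℕ → X)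
    (n : ℕ) (z : X) (c : Fin n → ℝ) :
    ‖φ z - ∑ j, c j • φ (x j)‖ ^ 2 + lam * ∑ j, c j ^ 2 =
      postVar k lam x n z + (c - weights k lam x n z) ⬝ᵥ
        regMatrix k lam x n *ᵥ (c - weights k lam x n z) := by
  have hA := regMatrix_mulVec_inv hk hlam x n (kernelVec k x n z)
  have hv : postVar k lam x n z = k z z - kernelVec k x n z ⬝ᵥ weights k lam x n z := rfl
  have h1 : weights k lam x n z ⬝ᵥ regMatrix k lam x n *ᵥ c = kernelVec k x n z ⬝ᵥ c := by
    rw [Matrix.dotProduct_mulVec, ← Matrix.mulVec_transpose, regMatrix_transpose hk]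
    simp only [weights]
    rw [hA]
  have h2 : c ⬝ᵥ regMatrix k lam x n *ᵥ c
      = ‖∑ j, c j • φ (x j)‖ ^ 2 + lam * ∑ j, c j ^ 2 := by
    rw [regMatrix_mulVec, dotProduct_add, dotProduct_kernelMatrix_mulVec hk,
      real_inner_self_eq_norm_sq, dotProduct_smul]
    simp [dotProduct, sq]
  rw [Matrix.mulVec_sub, sub_dotProduct, dotProduct_sub, dotProduct_sub, h1, h2, hv]
  simp only [weights] at hA ⊢
  rw [hA, dotProduct_comm c, dotProduct_comm _ (kernelVec k x n z), norm_sub_sq_real,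
    kernelVec_dotProduct hk x n z c, hk z z, real_inner_self_eq_norm_sq]
  ring

/-- The quadratic term of the ridge objective vanishes at its minimizer. Either summand alone is
later bounded by the variance. -/
lemma postVar_eq (hk : ∀ z w, k z w = ⟪φ z, φ w⟫_ℝ) (hlam : 0 < lam) (x : ℕ → X) (n : ℕ)
    (z : X) :
    postVar k lam x n z = ‖φ z - ∑ j, weights k lam x n z j • φ (x j)‖ ^ 2
      + lam * ∑ j, weights k lam x n z j ^ 2 := by
  simp [ridge_objective_eq hk hlam]

lemma postVar_le (hk : ∀ z w, k z w = ⟪φ z, φ w⟫_ℝ) (hlam : 0 < lam) (x : ℕ → X) (n : ℕ)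
    (z : X) (c : Fin n → ℝ) :
    postVar k lam x n z ≤ ‖φ z - ∑ j, c j • φ (x j)‖ ^ 2 + lam * ∑ j, c j ^ 2 := by
  rw [ridge_objective_eq hk hlam]
  have := (regMatrix_posDef hk hlam x n).posSemidef.dotProduct_mulVec_nonneg
    (c - weights k lam x n z)
  simpa using this

lemma postVar_nonneg (hk : ∀ z w, k z w = ⟪φ z, φ w⟫_ℝ) (hlam : 0 < lam) (x : ℕ → X) (n : ℕ)
    (z : X) : 0 ≤ postVar k lam x n z := by
  rw [postVar_eq hk hlam]; positivity

lemma postVar_le_diag (hk : ∀ z w, k z w = ⟪φ z, φ w⟫_ℝ) (hlam : 0 < lam) (x : ℕ → X) (n : ℕ)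
    (z : X) : postVar k lam x n z ≤ k z z := by
  simpa [hk] using postVar_le hk hlam x n z 0

lemma postVar_antitone (hk : ∀ z w, k z w = ⟪φ z, φ w⟫_ℝ) (hlam : 0 < lam) (x : ℕ → X)
    (z : X) : Antitone fun n => postVar k lam x n z := by
  refine antitone_nat_of_succ_le fun n => ?_
  rw [postVar_eq hk hlam x n]
  -- The old weights, padded with a zero, compete in the problem with one more point.
  simpa [Fin.sum_univ_castSucc] using postVar_le hk hlam x (n + 1) z
    (Fin.snoc (α := fun _ => ℝ) (weights k lam x n z) 0)

/-- Since y = Kv + λv, the energy is yᵀKv: squared fitted values plus λ times the squared norm of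
the fitted function. -/
lemma energy_eq (hk : ∀ z w, k z w = ⟪φ z, φ w⟫_ℝ) (hlam : 0 < lam) (x : ℕ → X) (y : ℕ → ℝ)
    (n : ℕ) {v : Fin n → ℝ} (hv : regMatrix k lam x n *ᵥ v = fun i : Fin n => y i) :
    energy k lam x y n = (∑ i, (kernelMatrix k x n *ᵥ v) i ^ 2)
      + lam * ‖∑ j, v j • φ (x j)‖ ^ 2 := by
  rw [energy, inv_regMatrix_mulVec_eq hk hlam hv]
  have h1 : ∀ i : Fin n, y i = (kernelMatrix k x n *ᵥ v) i + lam * v i := by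
    intro i
    rw [← congrFun hv i, regMatrix_mulVec]; simp
  have h2 := dotProduct_kernelMatrix_mulVec hk x n v v
  rw [real_inner_self_eq_norm_sq] at h2
  rw [← h2]
  simp only [dotProduct, Finset.mul_sum, ← Finset.sum_sub_distrib, ← Finset.sum_add_distrib, h1]
  refine Finset.sum_congr rfl fun i _ => ?_
  ring

/-- Noise enters the posterior mean at `z` with at most `λ^{-1/2} σ_n(z)` times its energy norm. -/
lemma sq_postMean_le (hk : ∀ z w, k z w = ⟪φ z, φ w⟫_ℝ) (hlam : 0 < lam) (x : ℕ → X)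
    (y : ℕ → ℝ) (n : ℕ) (z : X) :
    postMean k lam x y n z ^ 2 ≤ postVar k lam x n z * (lam⁻¹ * energy k lam x y n) := by
  set v := (regMatrix k lam x n)⁻¹ *ᵥ (fun i : Fin n => y i) with hvdef
  have hv : regMatrix k lam x n *ᵥ v = fun i : Fin n => y i := regMatrix_mulVec_inv hk hlam x n _
  set c := weights k lam x n z
  rw [energy_eq hk hlam x y n hv, postVar_eq hk hlam]
  have h1 : postMean k lam x y n z = ⟪φ z - ∑ j, c j • φ (x j), ∑ j, v j • φ (x j)⟫_ℝ
      + c ⬝ᵥ kernelMatrix k x n *ᵥ v := by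
    rw [inner_sub_left, dotProduct_kernelMatrix_mulVec hk, ← kernelVec_dotProduct hk,
      sub_add_cancel]
    rfl
  have h2 := abs_real_inner_le_norm (φ z - ∑ j, c j • φ (x j)) (∑ j, v j • φ (x j))
  have h3 : (c ⬝ᵥ kernelMatrix k x n *ᵥ v) ^ 2 ≤
      (∑ j, c j ^ 2) * ∑ i, (kernelMatrix k x n *ᵥ v) i ^ 2 :=
    Finset.sum_mul_sq_le_sq_mul_sq _ _ _
  rw [h1]
  set p := ⟪φ z - ∑ j, c j • φ (x j), ∑ j, v j • φ (x j)⟫_ℝ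
  set q := c ⬝ᵥ kernelMatrix k x n *ᵥ v
  set a := ‖φ z - ∑ j, c j • φ (x j)‖
  set b := ‖∑ j, v j • φ (x j)‖
  have hC : 0 ≤ ∑ j, c j ^ 2 := by positivity
  have hG : 0 ≤ ∑ i, (kernelMatrix k x n *ᵥ v) i ^ 2 := by positivity
  set C := ∑ j, c j ^ 2
  set G := ∑ i, (kernelMatrix k x n *ᵥ v) i ^ 2
  have h4 : |q| ≤ Real.sqrt C * Real.sqrt G := by
    rw [← Real.sqrt_mul hC]; exact Real.abs_le_sqrt h3
  have h5 : (p + q) ^ 2 ≤ (a * b + Real.sqrt C * Real.sqrt G) ^ 2 := by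
    refine sq_le_sq' ?_ ?_
    · linarith [neg_abs_le p, neg_abs_le q]
    · linarith [le_abs_self p, le_abs_self q]
  have hC' := Real.sq_sqrt hC
  have hG' := Real.sq_sqrt hG
  refine h5.trans ?_
  -- Lagrange's identity for Cauchy–Schwarz on the pairs (a, √(λC)) and (b, √(G/λ)).
  have h6 : (a ^ 2 + lam * C) * (lam⁻¹ * (G + lam * b ^ 2)) -
      (a * b + Real.sqrt C * Real.sqrt G) ^ 2
      = lam⁻¹ * (a * Real.sqrt G - lam * b * Real.sqrt C) ^ 2 := by
    rw [← hC', ← hG']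
    simp only [Real.sqrt_sq (Real.sqrt_nonneg _)]
    field_simp
    ring
  have : 0 ≤ lam⁻¹ * (a * Real.sqrt G - lam * b * Real.sqrt C) ^ 2 := by positivity
  linarith

/-- The posterior mean of exact observations of an element of the Hilbert space. -/
lemma abs_postMean_inner_sub_le (hk : ∀ z w, k z w = ⟪φ z, φ w⟫_ℝ) (hlam : 0 < lam)
    (x : ℕ → X) (n : ℕ) (z : X) (f : H) :
    |postMean k lam x (fun i => ⟪f, φ (x i)⟫_ℝ) n z - ⟪f, φ z⟫_ℝ|
      ≤ ‖f‖ * postStd k lam x n z := by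
  have h1 : postMean k lam x (fun i => ⟪f, φ (x i)⟫_ℝ) n z - ⟪f, φ z⟫_ℝ
      = - ⟪f, φ z - ∑ j, weights k lam x n z j • φ (x j)⟫_ℝ := by
    rw [postMean_eq_weights hk, inner_sub_right, inner_sum]
    simp [inner_smul_right]
  rw [h1, abs_neg]
  refine (abs_real_inner_le_norm _ _).trans ?_
  gcongr
  refine Real.le_sqrt_of_sq_le ?_
  rw [postVar_eq hk hlam]
  have : 0 ≤ lam * ∑ j, weights k lam x n z j ^ 2 := by positivity
  linarith

/-- The effect on the posterior mean of a bounded perturbation of the observations. -/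
lemma abs_postMean_le_of_bounded (hk : ∀ z w, k z w = ⟪φ z, φ w⟫_ℝ) (hlam : 0 < lam)
    (x : ℕ → X) (n : ℕ) (z : X) {g : ℕ → ℝ} {ε : ℝ} (hε : 0 ≤ ε) (hg : ∀ i < n, |g i| ≤ ε) :
    |postMean k lam x g n z| ≤ ε * Real.sqrt (n / lam) * postStd k lam x n z := by
  rw [postMean_eq_weights hk, mul_assoc, postStd, ← Real.sqrt_mul (by positivity),
    ← Real.sqrt_sq hε, ← Real.sqrt_mul (by positivity)]
  refine Real.abs_le_sqrt ?_
  refine (Finset.sum_mul_sq_le_sq_mul_sq _ _ _).trans ?_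
  have h1 : ∑ i : Fin n, g i ^ 2 ≤ n * ε ^ 2 := by
    have : ∀ i : Fin n, g i ^ 2 ≤ ε ^ 2 := fun i => by
      rw [← sq_abs]; exact pow_le_pow_left₀ (abs_nonneg _) (hg i i.2) 2
    simpa using Finset.sum_le_sum (s := Finset.univ) fun i _ => this i
  -- The variance controls the ℓ² norm of the weights; n perturbations of size ε then produce
  -- ε√(n/λ).
  have h2 : ∑ i, weights k lam x n z i ^ 2 ≤ postVar k lam x n z / lam := by
    rw [le_div_iff₀ hlam, postVar_eq hk hlam, mul_comm]
    have := sq_nonneg ‖φ z - ∑ j, weights k lam x n z j • φ (x j)‖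
    linarith
  have h3 := postVar_nonneg hk hlam x n z
  calc _ ≤ (postVar k lam x n z / lam) * (n * ε ^ 2) := by gcongr
    _ = _ := by ring

lemma postMean_add (x : ℕ → X) (y₁ y₂ : ℕ → ℝ) (n : ℕ) (z : X) :
    postMean k lam x (fun i => y₁ i + y₂ i) n z
      = postMean k lam x y₁ n z + postMean k lam x y₂ n z := by
  simp only [postMean, ← dotProduct_add, ← Matrix.mulVec_add]
  rfl

lemma regMatrix_succ_mulVec_snoc (hk : ∀ z w, k z w = ⟪φ z, φ w⟫_ℝ) (x : ℕ → X) (n : ℕ)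
    (u : Fin n → ℝ) (a : ℝ) :
    regMatrix k lam x (n + 1) *ᵥ (Fin.snoc (α := fun _ => ℝ) u a)
      = Fin.snoc (α := fun _ => ℝ) (regMatrix k lam x n *ᵥ u + a • kernelVec k x n (x n))
        (kernelVec k x n (x n) ⬝ᵥ u + (k (x n) (x n) + lam) * a) := by
  rw [regMatrix_mulVec, regMatrix_mulVec]
  ext i
  refine Fin.lastCases ?_ (fun i => ?_) i
  · simp [Matrix.mulVec, dotProduct, Fin.sum_univ_castSucc, kernelMatrix,
      kernelVec, hk, real_inner_comm]
    ring
  · simp [Matrix.mulVec, dotProduct, Fin.sum_univ_castSucc, kernelMatrix,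
      kernelVec]
    ring

lemma energy_zero (x : ℕ → X) (y : ℕ → ℝ) : energy k lam x y 0 = 0 := by
  simp [energy]

lemma energy_succ (hk : ∀ z w, k z w = ⟪φ z, φ w⟫_ℝ) (hlam : 0 < lam) (x : ℕ → X)
    (y : ℕ → ℝ) (n : ℕ) :
    energy k lam x y (n + 1) = energy k lam x y n + (y n ^ 2
      - lam * ((y n - postMean k lam x y n (x n)) ^ 2 / (lam + postVar k lam x n (x n)))) := by
  set v := (regMatrix k lam x n)⁻¹ *ᵥ (fun i : Fin n => y i) with hvdef
  have hv : regMatrix k lam x n *ᵥ v = fun i : Fin n => y i := regMatrix_mulVec_inv hk hlam x n _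
  set c := weights k lam x n (x n) with hc
  have hcA : regMatrix k lam x n *ᵥ c = kernelVec k x n (x n) := regMatrix_mulVec_inv hk hlam x n _
  have hm : postMean k lam x y n (x n) = kernelVec k x n (x n) ⬝ᵥ v := rfl
  have hm' : postMean k lam x y n (x n) = c ⬝ᵥ fun i : Fin n => y i :=
    postMean_eq_weights hk x y n (x n)
  have hs : postVar k lam x n (x n) = k (x n) (x n) - kernelVec k x n (x n) ⬝ᵥ c := rfl
  have hpos : 0 < lam + postVar k lam x n (x n) :=
    add_pos_of_pos_of_nonneg hlam (postVar_nonneg hk hlam x n (x n))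
  set m := postMean k lam x y n (x n)
  set s := postVar k lam x n (x n)
  -- Block elimination: the new coefficient is the prediction residual over `lam + s`, and the old
  -- ones are corrected by `α • c`.
  set α := (y n - m) / (lam + s) with hα
  have hα' : α * (lam + s) = y n - m := div_mul_cancel₀ _ hpos.ne'
  have hsol : regMatrix k lam x (n + 1) *ᵥ (Fin.snoc (α := fun _ => ℝ) (v - α • c) α)
      = fun i : Fin (n + 1) => y i := by
    rw [regMatrix_succ_mulVec_snoc hk, Matrix.mulVec_sub, Matrix.mulVec_smul, hv, hcA,
      sub_add_cancel, dotProduct_sub, dotProduct_smul, ← hm]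
    ext i
    refine Fin.lastCases ?_ (fun i => ?_) i
    · simp only [Fin.snoc_last, smul_eq_mul, Fin.val_last]
      have : kernelVec k x n (x n) ⬝ᵥ c = k (x n) (x n) - s := by rw [hs]; ring
      rw [this]; linarith
    · simp
  rw [energy, energy, inv_regMatrix_mulVec_eq hk hlam hsol, ← hvdef, Fin.sum_univ_castSucc]
  have h1 : (fun i : Fin (n + 1) => y i) ⬝ᵥ (Fin.snoc (α := fun _ => ℝ) (v - α • c) α)
      = (fun i : Fin n => y i) ⬝ᵥ v - α * m + y n * α := by
    rw [hm', dotProduct_comm c]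
    simp [dotProduct, Fin.sum_univ_castSucc, mul_sub, Finset.sum_sub_distrib, Finset.mul_sum,
      mul_left_comm]
  rw [h1]
  simp only [Fin.val_castSucc, Fin.val_last]
  have h2 : (y n - m) ^ 2 / (lam + s) = α * (y n - m) := by rw [hα]; ring
  rw [h2]; ring

/-- The Schur complement of the old block is λ plus the posterior variance at the new point. -/
lemma det_regMatrix_succ (hk : ∀ z w, k z w = ⟪φ z, φ w⟫_ℝ) (hlam : 0 < lam) (x : ℕ → X)
    (n : ℕ) :
    (regMatrix k lam x (n + 1)).det
      = (regMatrix k lam x n).det * (lam + postVar k lam x n (x n)) := by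
  let _ := Matrix.invertibleOfIsUnitDet _ (isUnit_det_regMatrix hk hlam x n)
  have h1 : (regMatrix k lam x (n + 1)).submatrix (finSumFinEquiv (m := n) (n := 1))
        (finSumFinEquiv (m := n) (n := 1))
      = Matrix.fromBlocks (regMatrix k lam x n) (Matrix.of fun i _ => kernelVec k x n (x n) i)
        (Matrix.of fun _ i => kernelVec k x n (x n) i)
        (Matrix.of fun _ _ => k (x n) (x n) + lam) := by
    ext i j
    rcases i with i | i <;> rcases j with j | j <;>
      simp [regMatrix, kernelMatrix, kernelVec, Matrix.one_apply, Fin.ext_iff, hk,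
        real_inner_comm]
    · omega
    · omega
  rw [← Matrix.det_submatrix_equiv_self (finSumFinEquiv (m := n) (n := 1)), h1,
    Matrix.det_fromBlocks₁₁]
  congr 1
  rw [Matrix.det_fin_one]
  have : postVar k lam x n (x n) = k (x n) (x n)
    - kernelVec k x n (x n) ⬝ᵥ (regMatrix k lam x n)⁻¹ *ᵥ kernelVec k x n (x n) := rfl
  rw [this, Matrix.invOf_eq_nonsing_inv, Matrix.dotProduct_mulVec]
  simp only [Matrix.sub_apply, Matrix.of_apply, Matrix.mul_apply, dotProduct, Matrix.vecMul]
  ring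

/-- Chain rule for information: the successive Schur complements multiply. -/
lemma log_det_eq (hk : ∀ z w, k z w = ⟪φ z, φ w⟫_ℝ) (hlam : 0 < lam) (x : ℕ → X) (n : ℕ) :
    Real.log (1 + lam⁻¹ • kernelMatrix k x n).det
      = ∑ i ∈ Finset.range n, Real.log (1 + lam⁻¹ * postVar k lam x i (x i)) := by
  have h1 : (1 + lam⁻¹ • kernelMatrix k x n) = lam⁻¹ • regMatrix k lam x n := by
    rw [regMatrix, smul_add, smul_smul, inv_mul_cancel₀ hlam.ne', one_smul, add_comm]
  have h2 : (lam⁻¹ • regMatrix k lam x n).det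
      = ∏ i ∈ Finset.range n, (1 + lam⁻¹ * postVar k lam x i (x i)) := by
    rw [Matrix.det_smul, Fintype.card_fin]
    induction n with
    | zero => simp
    | succ n ih =>
      rw [Finset.prod_range_succ, ← ih (by
        rw [regMatrix, smul_add, smul_smul, inv_mul_cancel₀ hlam.ne', one_smul, add_comm]),
        det_regMatrix_succ hk hlam, pow_succ]
      field_simp
  rw [h1, h2, Real.log_prod]
  intro i _
  have := postVar_nonneg hk hlam x i (x i)
  positivity

end Kernel

/-! ### Information gain and the decay of the posterior variance -/

section InfoGain

variable {X H : Type*} [NormedAddCommGroup H] [InnerProductSpace ℝ H]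
  {φ : X → H} {k : X → X → ℝ} {lam : ℝ}

lemma half_log_det_eq [Nonempty X] (hk : ∀ z w, k z w = ⟪φ z, φ w⟫_ℝ) (hlam : 0 < lam) {n : ℕ}
    (s : Fin n → X) :
    ∃ x : ℕ → X, (∀ i : Fin n, x i = s i) ∧
      (1 / 2) * Real.log (Matrix.det
        ((1 : Matrix (Fin n) (Fin n) ℝ) + lam⁻¹ • Matrix.of fun i j => k (s i) (s j)))
      = (1 / 2) * ∑ i ∈ Finset.range n, Real.log (1 + lam⁻¹ * postVar k lam x i (x i)) := by
  -- Entries from index `n` on are never read, so any default point will do.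
  refine ⟨fun i => if h : i < n then s ⟨i, h⟩ else Classical.arbitrary X, by simp, ?_⟩
  rw [← log_det_eq hk hlam]
  congr
  ext i j
  simp

/-- An unbounded real supremum is 0 by convention, so `infoGain` dominates its members only once
boundedness is known. -/
lemma bddAbove_infoGain [Nonempty X] (hk : ∀ z w, k z w = ⟪φ z, φ w⟫_ℝ) (hlam : 0 < lam)
    (hk1 : ∀ z, k z z ≤ 1) (n : ℕ) :
    BddAbove (Set.range fun s : Fin n → X => (1 / 2) * Real.log (Matrix.det
      ((1 : Matrix (Fin n) (Fin n) ℝ) + lam⁻¹ • Matrix.of fun i j => k (s i) (s j)))) := by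
  refine ⟨(1 / 2) * ∑ i ∈ Finset.range n, Real.log (1 + lam⁻¹ * 1), ?_⟩
  rintro _ ⟨s, rfl⟩
  obtain ⟨x, -, hx⟩ := half_log_det_eq hk hlam s
  simp only [hx]
  gcongr with i _
  · have := postVar_nonneg hk hlam x i (x i); positivity
  · exact (postVar_le_diag hk hlam x i (x i)).trans (hk1 _)

lemma sum_log_le_infoGain [Nonempty X] (hk : ∀ z w, k z w = ⟪φ z, φ w⟫_ℝ) (hlam : 0 < lam)
    (hk1 : ∀ z, k z z ≤ 1) (x : ℕ → X) (n : ℕ) :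
    ∑ i ∈ Finset.range n, Real.log (1 + lam⁻¹ * postVar k lam x i (x i))
      ≤ 2 * infoGain k lam n := by
  have := le_ciSup (bddAbove_infoGain hk hlam hk1 n) (fun i : Fin n => x i)
  have h2 := log_det_eq hk hlam x n
  simp only [kernelMatrix] at h2
  rw [← h2]
  simp only [infoGain]
  linarith

lemma infoGain_mono [Nonempty X] (hk : ∀ z w, k z w = ⟪φ z, φ w⟫_ℝ) (hlam : 0 < lam)
    (hk1 : ∀ z, k z z ≤ 1) : Monotone (infoGain k lam) := by
  refine monotone_nat_of_le_succ fun n => ciSup_le fun s => ?_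
  obtain ⟨x, -, hx⟩ := half_log_det_eq hk hlam s
  rw [hx]
  have h1 := sum_log_le_infoGain hk hlam hk1 x (n + 1)
  rw [Finset.sum_range_succ] at h1
  have h2 : 0 ≤ Real.log (1 + lam⁻¹ * postVar k lam x n (x n)) := by
    refine Real.log_nonneg ?_
    have := postVar_nonneg hk hlam x n (x n)
    have : 0 ≤ lam⁻¹ * postVar k lam x n (x n) := by positivity
    linarith
  linarith

/-- A lower bound on the information gain independent of `n`, by which terms without γ are absorbed
into the final rate. -/
lemma le_infoGain_of_le_diag (hk : ∀ z w, k z w = ⟪φ z, φ w⟫_ℝ) (hlam : 0 < lam)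
    (hk1 : ∀ z, k z z ≤ 1) {kappa : ℝ} (hkappa : 0 < kappa) {z : X} (hz : kappa ≤ k z z) {n : ℕ}
    (hn : 1 ≤ n) : (1 / 2) * Real.log (1 + lam⁻¹ * kappa) ≤ infoGain k lam n := by
  have : Nonempty X := ⟨z⟩
  refine le_trans ?_ (infoGain_mono hk hlam hk1 hn)
  have h := sum_log_le_infoGain hk hlam hk1 (fun _ => z) 1
  have h0 : postVar k lam (fun _ => z) 0 z = k z z := by simp [postVar]
  rw [Finset.sum_range_one, h0] at h
  have : Real.log (1 + lam⁻¹ * kappa) ≤ Real.log (1 + lam⁻¹ * k z z) := by gcongr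
  linarith

/-- Converts variance into information: for u ≤ λ⁻¹ it gives u ≤ (2 + λ⁻¹) · ½ log(1 + u), the
source of the constant 2 + λ⁻¹. -/
lemma two_mul_le_mul_log {u : ℝ} (hu : 0 ≤ u) : 2 * u ≤ (2 + u) * Real.log (1 + u) := by
  have h := Real.le_log_one_add_of_nonneg hu
  rw [div_le_iff₀ (by positivity)] at h
  linarith

lemma sum_postVar_le [Nonempty X] (hk : ∀ z w, k z w = ⟪φ z, φ w⟫_ℝ) (hlam : 0 < lam)
    (hk1 : ∀ z, k z z ≤ 1) (x : ℕ → X) (n : ℕ) :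
    ∑ i ∈ Finset.range n, postVar k lam x i (x i)
      ≤ lam * ((2 + lam⁻¹) * infoGain k lam n) := by
  have h1 : ∀ i, postVar k lam x i (x i) ≤
      lam * ((2 + lam⁻¹) * (Real.log (1 + lam⁻¹ * postVar k lam x i (x i)) / 2)) := by
    intro i
    have h0 := postVar_nonneg hk hlam x i (x i)
    have h1 := (postVar_le_diag hk hlam x i (x i)).trans (hk1 _)
    set s := postVar k lam x i (x i)
    have hu : 0 ≤ lam⁻¹ * s := by positivity
    have h2 := two_mul_le_mul_log hu
    have hlog : 0 ≤ Real.log (1 + lam⁻¹ * s) := Real.log_nonneg (by linarith)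
    have h3 : lam⁻¹ * s ≤ lam⁻¹ := mul_le_of_le_one_right (by positivity) h1
    have h4 : (2 + lam⁻¹ * s) * Real.log (1 + lam⁻¹ * s)
        ≤ (2 + lam⁻¹) * Real.log (1 + lam⁻¹ * s) := by gcongr
    calc s = lam * (lam⁻¹ * s) := by field_simp
      _ ≤ _ := mul_le_mul_of_nonneg_left (by linarith) hlam.le
  refine (Finset.sum_le_sum fun i _ => h1 i).trans ?_
  rw [← Finset.mul_sum, ← Finset.mul_sum, ← Finset.sum_div]
  have := sum_log_le_infoGain hk hlam hk1 x n
  gcongr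
  linarith

/-- Uncertainty sampling over a set reduces the posterior variance on all of this set. -/
lemma mul_postVar_le_of_isMaxOn [Nonempty X] (hk : ∀ z w, k z w = ⟪φ z, φ w⟫_ℝ) (hlam : 0 < lam)
    (hk1 : ∀ z, k z z ≤ 1) {S : Set X} {x : ℕ → X} {n : ℕ}
    (hx : ∀ i < n, IsMaxOn (postVar k lam x i) S (x i)) {z : X} (hz : z ∈ S) :
    n * postVar k lam x n z ≤ lam * ((2 + lam⁻¹) * infoGain k lam n) := by
  refine le_trans ?_ (sum_postVar_le hk hlam hk1 x n)
  -- Each sampled point dominates `S` when chosen, and variances only fall afterwards, so the final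
  -- variance at `z` is below every summand.
  have : ∀ i ∈ Finset.range n, postVar k lam x n z ≤ postVar k lam x i (x i) := fun i hi => by
    have hi := Finset.mem_range.1 hi
    exact (postVar_antitone hk hlam x z hi.le).trans (hx i hi hz)
  simpa using Finset.sum_le_sum this

end InfoGain

/-! ### Exponential quadratic moments of sub-Gaussian noise -/

lemma lintegral_exp_quadratic_gaussianReal {a : ℝ} (ha : a < 1) (c d : ℝ) :
    ∫⁻ g, ENNReal.ofReal (Real.exp (a * g ^ 2 / 2 + c * g + d)) ∂(gaussianReal 0 1)
      = ENNReal.ofReal ((Real.sqrt (1 - a))⁻¹ * Real.exp (c ^ 2 / (2 * (1 - a)) + d)) := by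
  have h1a : 0 < 1 - a := by linarith
  set v : NNReal := Real.toNNReal (1 - a)⁻¹ with hv
  have hv' : (v : ℝ) = (1 - a)⁻¹ := Real.coe_toNNReal _ (by positivity)
  have hv0 : v ≠ 0 := by
    rw [hv]; simpa using ha
  set K := (Real.sqrt (1 - a))⁻¹ * Real.exp (c ^ 2 / (2 * (1 - a)) + d) with hK
  have hK0 : 0 ≤ K := by positivity
  rw [gaussianReal_of_var_ne_zero 0 one_ne_zero,
    lintegral_withDensity_eq_lintegral_mul _ (by fun_prop) (by fun_prop)]
  -- Completing the square leaves `K` times the Gaussian density of mean c/(1 - a) and variance 1/(1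
  -- - a).
  have h2 : ∀ g, (gaussianPDF 0 1 * fun g =>
      ENNReal.ofReal (Real.exp (a * g ^ 2 / 2 + c * g + d))) g
      = ENNReal.ofReal K * gaussianPDF (c / (1 - a)) v g := by
    intro g
    simp only [Pi.mul_apply, gaussianPDF]
    rw [← ENNReal.ofReal_mul (gaussianPDFReal_nonneg _ _ _), ← ENNReal.ofReal_mul hK0]
    congr 1
    simp only [gaussianPDFReal, hv', NNReal.coe_one, mul_one]
    rw [hK, Real.sqrt_mul (by positivity) (1 - a)⁻¹, Real.sqrt_inv, mul_inv, inv_inv]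
    have h3 : Real.exp (-(g - 0) ^ 2 / 2) * Real.exp (a * g ^ 2 / 2 + c * g + d)
        = Real.exp (c ^ 2 / (2 * (1 - a)) + d)
          * Real.exp (-(g - c / (1 - a)) ^ 2 / (2 * (1 - a)⁻¹)) := by
      rw [← Real.exp_add, ← Real.exp_add]
      congr 1
      field_simp
      ring
    rw [mul_assoc, h3]
    have : Real.sqrt (1 - a) ≠ 0 := by positivity
    field_simp
  simp_rw [h2]
  rw [lintegral_const_mul _ (by fun_prop), lintegral_gaussianPDF_eq_one _ hv0, mul_one]

lemma lintegral_exp_mul_gaussianReal (t : ℝ) :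
    ∫⁻ g, ENNReal.ofReal (Real.exp (t * g)) ∂(gaussianReal 0 1)
      = ENNReal.ofReal (Real.exp (t ^ 2 / 2)) := by
  simpa using lintegral_exp_quadratic_gaussianReal zero_lt_one t 0

/-- A sub-Gaussian variable has the exponential quadratic moments of a Gaussian one, at most. -/
lemma lintegral_exp_quadratic_le {Ω : Type*} {mΩ : MeasurableSpace Ω} {P : Measure Ω}
    [IsProbabilityMeasure P] {η : Ω → ℝ} {sigma : ℝ} (hsigma : 0 < sigma)
    (hη : HasSubgaussianMGF η (Real.toNNReal (sigma ^ 2)) P) {a : ℝ} (ha0 : 0 ≤ a) (ha : a < 1)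
    (b : ℝ) :
    ∫⁻ ω, ENNReal.ofReal (Real.exp (a * η ω ^ 2 / (2 * sigma ^ 2) + b * η ω)) ∂P
      ≤ ENNReal.ofReal ((Real.sqrt (1 - a))⁻¹
          * Real.exp (b ^ 2 * sigma ^ 2 / (2 * (1 - a)))) := by
  have hm : AEMeasurable η P := hη.aemeasurable
  have hsq : Real.sqrt a ^ 2 = a := Real.sq_sqrt ha0
  -- A Gaussian average linearizes the square: exp(aη²/(2σ²)) is the mean of exp(√a g η/σ) over
  -- standard Gaussian g. After Tonelli the sub-Gaussian bound applies at each fixed `g`.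
  calc ∫⁻ ω, ENNReal.ofReal (Real.exp (a * η ω ^ 2 / (2 * sigma ^ 2) + b * η ω)) ∂P
      = ∫⁻ ω, ∫⁻ g, ENNReal.ofReal (Real.exp ((Real.sqrt a * g / sigma + b) * η ω))
          ∂(gaussianReal 0 1) ∂P := by
        refine lintegral_congr fun ω => ?_
        have h1 : ∀ g, ENNReal.ofReal (Real.exp ((Real.sqrt a * g / sigma + b) * η ω))
            = ENNReal.ofReal (Real.exp (b * η ω))
              * ENNReal.ofReal (Real.exp ((Real.sqrt a * η ω / sigma) * g)) := fun g => by
          rw [← ENNReal.ofReal_mul (by positivity), ← Real.exp_add]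
          congr 2; ring
        simp_rw [h1]
        rw [lintegral_const_mul _ (by fun_prop), lintegral_exp_mul_gaussianReal,
          ← ENNReal.ofReal_mul (by positivity), ← Real.exp_add]
        congr 2
        rw [div_pow, mul_pow, hsq]
        ring
    _ = ∫⁻ g, ∫⁻ ω, ENNReal.ofReal (Real.exp ((Real.sqrt a * g / sigma + b) * η ω)) ∂P
          ∂(gaussianReal 0 1) := by
        refine lintegral_lintegral_swap ?_
        have : AEMeasurable (fun q : Ω × ℝ => η q.1) (P.prod (gaussianReal 0 1)) :=
          hm.comp_quasiMeasurePreserving Measure.quasiMeasurePreserving_fst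
        simp only [Function.uncurry_def]
        fun_prop
    _ ≤ ∫⁻ g, ENNReal.ofReal (Real.exp (a * g ^ 2 / 2 + (Real.sqrt a * sigma * b) * g
          + sigma ^ 2 * b ^ 2 / 2)) ∂(gaussianReal 0 1) := by
        refine lintegral_mono fun g => ?_
        rw [← ofReal_integral_eq_lintegral_ofReal (hη.integrable_exp_mul _)
          (Filter.Eventually.of_forall fun _ => (Real.exp_pos _).le)]
        refine ENNReal.ofReal_le_ofReal ((hη.mgf_le _).trans (le_of_eq ?_))
        rw [Real.coe_toNNReal _ (sq_nonneg _)]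
        congr 1
        have : (Real.sqrt a * g / sigma + b) ^ 2 = a * g ^ 2 / sigma ^ 2
            + 2 * Real.sqrt a * g * b / sigma + b ^ 2 := by
          rw [add_sq, div_pow, mul_pow, hsq]; ring
        rw [this]
        field_simp
    _ = _ := by
        rw [lintegral_exp_quadratic_gaussianReal ha]
        have h1a : 0 < 1 - a := by linarith
        congr 3
        rw [mul_pow, mul_pow, hsq]
        field_simp
        ring

/-- Expanding in η leaves the quadratic coefficient a = s/(λ + s) < 1. The factor (1 - a)^(-1/2) =
√(1 + λ⁻¹s) is cancelled by the logarithm, and the two m² terms cancel each other. -/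
lemma lintegral_exp_ridge_increment_le {Ω : Type*} {mΩ : MeasurableSpace Ω} {P : Measure Ω}
    [IsProbabilityMeasure P] {η : Ω → ℝ} {sigma : ℝ} (hsigma : 0 < sigma)
    (hη : HasSubgaussianMGF η (Real.toNNReal (sigma ^ 2)) P) {lam s : ℝ} (hlam : 0 < lam)
    (hs : 0 ≤ s) (m : ℝ) :
    ∫⁻ ω, ENNReal.ofReal (Real.exp ((η ω ^ 2 - lam * ((η ω - m) ^ 2 / (lam + s)))
      / (2 * sigma ^ 2) - Real.log (1 + lam⁻¹ * s) / 2)) ∂P ≤ 1 := by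
  have hls : 0 < lam + s := by linarith
  set a := s / (lam + s) with ha
  have ha0 : 0 ≤ a := by positivity
  have h1a : 1 - a = lam / (lam + s) := by rw [ha]; field_simp; ring
  have ha1 : a < 1 := by
    have : 0 < 1 - a := by rw [h1a]; positivity
    linarith
  set b := (1 - a) * m / sigma ^ 2 with hb
  set r := (1 - a) * m ^ 2 / (2 * sigma ^ 2) + Real.log (1 + lam⁻¹ * s) / 2 with hr
  have h1 : ∀ ω, ENNReal.ofReal (Real.exp ((η ω ^ 2 - lam * ((η ω - m) ^ 2 / (lam + s)))
      / (2 * sigma ^ 2) - Real.log (1 + lam⁻¹ * s) / 2))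
      = ENNReal.ofReal (Real.exp (-r))
        * ENNReal.ofReal (Real.exp (a * η ω ^ 2 / (2 * sigma ^ 2) + b * η ω)) := by
    intro ω
    rw [← ENNReal.ofReal_mul (by positivity), ← Real.exp_add]
    congr 2
    rw [hr, hb, h1a, ha]
    field_simp
    ring
  simp_rw [h1]
  rw [lintegral_const_mul' _ _ ENNReal.ofReal_ne_top]
  refine (mul_le_mul_right (lintegral_exp_quadratic_le hsigma hη ha0 ha1 b) _).trans ?_
  rw [← ENNReal.ofReal_mul (by positivity), ENNReal.ofReal_le_one]
  have h2 : (Real.sqrt (1 - a))⁻¹ = Real.exp (Real.log (1 + lam⁻¹ * s) / 2) := by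
    rw [← Real.sqrt_inv, h1a, Real.exp_half, Real.exp_log (by positivity)]
    congr 1
    field_simp
  rw [h2, ← Real.exp_add, ← Real.exp_add, Real.exp_le_one_iff, hr, hb]
  have h1a' : 0 < 1 - a := by linarith
  refine le_of_eq ?_
  field_simp
  ring

/-! ### Measurability of the posterior quantities -/

section Measurability

variable {Ω X : Type*} [MeasurableSpace X] {k : X → X → ℝ} {lam : ℝ}

lemma measurable_det {m : MeasurableSpace Ω} {n : ℕ} {A : Ω → Matrix (Fin n) (Fin n) ℝ}
    (hA : ∀ i j, Measurable fun ω => A ω i j) : Measurable fun ω => (A ω).det := by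
  simp only [Matrix.det_apply']
  exact Finset.measurable_sum _ fun σ _ =>
    (Finset.measurable_prod _ fun i _ => hA _ _).const_mul _

/-- Cramer's rule; real inversion is measurable with 0⁻¹ = 0, so singular matrices need no
exception. -/
lemma measurable_inv_apply {m : MeasurableSpace Ω} {n : ℕ} {A : Ω → Matrix (Fin n) (Fin n) ℝ}
    (hA : ∀ i j, Measurable fun ω => A ω i j) (i j : Fin n) :
    Measurable fun ω => (A ω)⁻¹ i j := by
  simp only [Matrix.inv_def, Ring.inverse_eq_inv', Matrix.smul_apply, smul_eq_mul,
    Matrix.adjugate_apply]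
  refine (measurable_det hA).inv.mul (measurable_det fun a b => ?_)
  simp only [Matrix.updateRow_apply]
  split_ifs
  · exact measurable_const
  · exact hA a b

lemma measurable_dotProduct_inv_mulVec {m : MeasurableSpace Ω} {n : ℕ}
    {A : Ω → Matrix (Fin n) (Fin n) ℝ} (hA : ∀ i j, Measurable fun ω => A ω i j)
    {u v : Ω → Fin n → ℝ} (hu : ∀ i, Measurable fun ω => u ω i)
    (hv : ∀ i, Measurable fun ω => v ω i) :
    Measurable fun ω => u ω ⬝ᵥ (A ω)⁻¹ *ᵥ v ω := by
  simp only [dotProduct, Matrix.mulVec]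
  exact Finset.measurable_sum _ fun i _ => (hu i).mul <|
    Finset.measurable_sum _ fun j _ => (measurable_inv_apply hA i j).mul (hv j)

lemma measurable_kernel_comp {m : MeasurableSpace Ω} (hk : Measurable fun q : X × X => k q.1 q.2)
    {u v : Ω → X} (hu : Measurable u) (hv : Measurable v) : Measurable fun ω => k (u ω) (v ω) :=
  hk.comp (hu.prodMk hv)

lemma measurable_regMatrix_apply {m : MeasurableSpace Ω}
    (hk : Measurable fun q : X × X => k q.1 q.2) {x : ℕ → Ω → X} {n : ℕ}
    (hx : ∀ i < n, Measurable (x i)) (i j : Fin n) :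
    Measurable fun ω => regMatrix k lam (fun t => x t ω) n i j := by
  simp only [regMatrix, kernelMatrix, Matrix.add_apply, Matrix.of_apply]
  exact (measurable_kernel_comp hk (hx i i.2) (hx j j.2)).add_const _

lemma measurable_postVar {m : MeasurableSpace Ω}
    (hk : Measurable fun q : X × X => k q.1 q.2) {x : ℕ → Ω → X} {n : ℕ}
    (hx : ∀ i < n, Measurable (x i)) {z : Ω → X} (hz : Measurable z) :
    Measurable fun ω => postVar k lam (fun t => x t ω) n (z ω) :=
  (measurable_kernel_comp hk hz hz).sub <| measurable_dotProduct_inv_mulVec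
    (measurable_regMatrix_apply hk hx) (fun i => measurable_kernel_comp hk (hx i i.2) hz)
    (fun i => measurable_kernel_comp hk (hx i i.2) hz)

lemma measurable_postMean {m : MeasurableSpace Ω}
    (hk : Measurable fun q : X × X => k q.1 q.2) {x : ℕ → Ω → X} {y : ℕ → Ω → ℝ} {n : ℕ}
    (hx : ∀ i < n, Measurable (x i)) (hy : ∀ i < n, Measurable (y i)) {z : Ω → X}
    (hz : Measurable z) :
    Measurable fun ω => postMean k lam (fun t => x t ω) (fun t => y t ω) n (z ω) :=
  measurable_dotProduct_inv_mulVec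
    (measurable_regMatrix_apply hk hx) (fun i => measurable_kernel_comp hk (hx i i.2) hz)
    (fun i => hy i i.2)

lemma measurable_energy {m : MeasurableSpace Ω}
    (hk : Measurable fun q : X × X => k q.1 q.2) {x : ℕ → Ω → X} {y : ℕ → Ω → ℝ} {n : ℕ}
    (hx : ∀ i < n, Measurable (x i)) (hy : ∀ i < n, Measurable (y i)) :
    Measurable fun ω => energy k lam (fun t => x t ω) (fun t => y t ω) n := by
  have h : Measurable fun ω => ∑ i : Fin n, y i ω ^ 2 :=
    Finset.measurable_sum _ fun i _ => (hy i i.2).pow_const 2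
  exact h.sub <| (measurable_dotProduct_inv_mulVec (measurable_regMatrix_apply hk hx)
      (fun i => hy i i.2) (fun i => hy i i.2)).const_mul _

end Measurability

/-! ### Self-normalized concentration of the noise -/

lemma lintegral_indep_pair {Ω β : Type*} [MeasurableSpace β] {m mΩ : MeasurableSpace Ω}
    {P : Measure Ω} [IsProbabilityMeasure P] (hm : m ≤ mΩ)
    {Y : Ω → β} (hY : Measurable[m] Y) {η : Ω → ℝ} (hη : Measurable η)
    (hind : Indep (MeasurableSpace.comap η inferInstance) m P) {F : β × ℝ → ENNReal}
    (hF : Measurable F) :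
    ∫⁻ ω, F (Y ω, η ω) ∂P = ∫⁻ ω, ∫⁻ ω', F (Y ω, η ω') ∂P ∂P := by
  have hY' : Measurable Y := hY.mono hm le_rfl
  have hind' : IndepFun Y η P := by
    rw [IndepFun_iff_Indep]
    exact indep_of_indep_of_le_left hind.symm hY.comap_le
  -- The joint law is a product, so Tonelli averages the noise with the past frozen, in place of a
  -- conditional expectation.
  have h1 := hind'.map_prod_eq_prod_map_map hY'.aemeasurable hη.aemeasurable
  rw [← lintegral_map hF (hY'.prodMk hη), h1, lintegral_prod _ hF.aemeasurable,
    lintegral_map hF.lintegral_prod_right' hY']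
  refine lintegral_congr fun ω => ?_
  exact lintegral_map (hF.comp measurable_prodMk_left) hη

section Noise

variable {Ω X H : Type*} [NormedAddCommGroup H] [InnerProductSpace ℝ H]
  [MeasurableSpace X] {φ : X → H} {k : X → X → ℝ} {lam sigma : ℝ}
  {mΩ : MeasurableSpace Ω} {P : Measure Ω} [IsProbabilityMeasure P]
  {ℱ : ℕ → MeasurableSpace Ω} {η : ℕ → Ω → ℝ} {x : ℕ → Ω → X}

/-- The self-normalized supermartingale of the noise has expectation at most one. -/
lemma lintegral_exp_energy_le (hk : ∀ z w, k z w = ⟪φ z, φ w⟫_ℝ) (hlam : 0 < lam)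
    (hkm : Measurable fun q : X × X => k q.1 q.2) (hsigma : 0 < sigma) (hmono : Monotone ℱ)
    (hle : ∀ t, ℱ t ≤ mΩ) (n : ℕ)
    (hη : ∀ t < n, HasSubgaussianMGF (η t) (Real.toNNReal (sigma ^ 2)) P)
    (hηm : ∀ t < n, Measurable[ℱ (t + 1)] (η t))
    (hind : ∀ t < n, Indep (MeasurableSpace.comap (η t) inferInstance) (ℱ t) P)
    (hx : ∀ t < n, Measurable[ℱ t] (x t)) :
    ∫⁻ ω, ENNReal.ofReal (Real.exp
      (energy k lam (fun t => x t ω) (fun t => η t ω) n / (2 * sigma ^ 2)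
      - (∑ i ∈ Finset.range n,
        Real.log (1 + lam⁻¹ * postVar k lam (fun t => x t ω) i (x i ω))) / 2)) ∂P ≤ 1 := by
  induction n with
  | zero => simp [energy_zero]
  | succ n ih =>
    specialize ih (fun t ht => hη t (ht.trans n.lt_succ_self))
      (fun t ht => hηm t (ht.trans n.lt_succ_self))
      (fun t ht => hind t (ht.trans n.lt_succ_self))
      (fun t ht => hx t (ht.trans n.lt_succ_self))
    set V : Ω → ℝ := fun ω => energy k lam (fun t => x t ω) (fun t => η t ω) n / (2 * sigma ^ 2)
      - (∑ i ∈ Finset.range n,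
        Real.log (1 + lam⁻¹ * postVar k lam (fun t => x t ω) i (x i ω))) / 2 with hV
    set M : Ω → ℝ := fun ω => postMean k lam (fun t => x t ω) (fun t => η t ω) n (x n ω)
    set S : Ω → ℝ := fun ω => postVar k lam (fun t => x t ω) n (x n ω)
    have hxn : ∀ i < n + 1, Measurable[ℱ n] (x i) := fun i hi =>
      (hx i hi).mono (hmono (Nat.lt_succ_iff.1 hi)) le_rfl
    have hxn' : ∀ i < n, Measurable[ℱ n] (x i) := fun i hi => hxn i (hi.trans n.lt_succ_self)
    have hηn : ∀ i < n, Measurable[ℱ n] (η i) := fun i hi =>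
      (hηm i (hi.trans n.lt_succ_self)).mono (hmono hi) le_rfl
    have hMm : Measurable[ℱ n] M := measurable_postMean hkm hxn' hηn (hxn n n.lt_succ_self)
    have hSm : Measurable[ℱ n] S := measurable_postVar hkm hxn' (hxn n n.lt_succ_self)
    have hVm : Measurable[ℱ n] V := by
      refine ((measurable_energy hkm hxn' hηn).div_const _).sub
        ((Finset.measurable_sum _ fun i hi => ?_).div_const _)
      have hi := Finset.mem_range.1 hi
      exact Real.measurable_log.comp (((measurable_postVar hkm
        (fun j hj => hxn' j (hj.trans hi)) (hxn' i hi)).const_mul _).const_add _)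
    -- The new exponent depends on the past only through the old exponent and the mean and variance
    -- at the new point; this triple is what gets frozen.
    have hYm : Measurable[ℱ n] fun ω => (V ω, M ω, S ω) := hVm.prodMk (hMm.prodMk hSm)
    set F : (ℝ × ℝ × ℝ) × ℝ → ENNReal := fun q => ENNReal.ofReal (Real.exp q.1.1) *
      ENNReal.ofReal (Real.exp ((q.2 ^ 2 - lam * ((q.2 - q.1.2.1) ^ 2 / (lam + q.1.2.2)))
      / (2 * sigma ^ 2) - Real.log (1 + lam⁻¹ * q.1.2.2) / 2)) with hF
    have hFm : Measurable F := by fun_prop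
    have h1 : ∀ ω, ENNReal.ofReal (Real.exp
      (energy k lam (fun t => x t ω) (fun t => η t ω) (n + 1) / (2 * sigma ^ 2)
      - (∑ i ∈ Finset.range (n + 1),
        Real.log (1 + lam⁻¹ * postVar k lam (fun t => x t ω) i (x i ω))) / 2))
        = F ((V ω, M ω, S ω), η n ω) := by
      intro ω
      rw [hF]
      simp only
      rw [← ENNReal.ofReal_mul (by positivity), ← Real.exp_add,
        energy_succ hk hlam, Finset.sum_range_succ]
      congr 2
      simp only [hV, M, S]
      ring
    simp_rw [h1]
    rw [lintegral_indep_pair (hle n) hYm ((hηm n n.lt_succ_self).mono (hle _) le_rfl)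
      (hind n n.lt_succ_self) hFm]
    refine (lintegral_mono fun ω => ?_).trans ih
    simp only [hF]
    rw [lintegral_const_mul' _ _ ENNReal.ofReal_ne_top]
    exact mul_le_of_le_one_right zero_le (lintegral_exp_ridge_increment_le hsigma
      (hη n n.lt_succ_self) hlam (postVar_nonneg hk hlam _ _ _) _)

/-- The self-normalized concentration inequality. -/
lemma measure_energy_gt_le (hk : ∀ z w, k z w = ⟪φ z, φ w⟫_ℝ) (hlam : 0 < lam)
    (hkm : Measurable fun q : X × X => k q.1 q.2) (hsigma : 0 ≤ sigma) (hmono : Monotone ℱ)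
    (hle : ∀ t, ℱ t ≤ mΩ) (n : ℕ)
    (hη : ∀ t < n, HasSubgaussianMGF (η t) (Real.toNNReal (sigma ^ 2)) P)
    (hηm : ∀ t < n, Measurable[ℱ (t + 1)] (η t))
    (hind : ∀ t < n, Indep (MeasurableSpace.comap (η t) inferInstance) (ℱ t) P)
    (hx : ∀ t < n, Measurable[ℱ t] (x t)) {delta : ℝ} (hdelta : 0 < delta) :
    P {ω | ¬ energy k lam (fun t => x t ω) (fun t => η t ω) n ≤ sigma ^ 2 *
      (2 * Real.log (1 / delta) + ∑ i ∈ Finset.range n,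
        Real.log (1 + lam⁻¹ * postVar k lam (fun t => x t ω) i (x i ω)))}
      ≤ ENNReal.ofReal delta := by
  -- The exponent divides by σ², so σ = 0 is separate: the noise, hence the energy, then vanishes
  -- almost surely.
  rcases hsigma.eq_or_lt with rfl | hsigma
  · have h0 : ∀ᵐ ω ∂P, ∀ t < n, η t ω = 0 := by
      rw [ae_all_iff]; intro t
      rw [Filter.eventually_imp_distrib_left]
      intro ht
      have := hη t ht
      simp only [ne_eq, OfNat.ofNat_ne_zero, not_false_eq_true, zero_pow,
        Real.toNNReal_zero] at this
      exact this.ae_eq_zero_of_hasSubgaussianMGF_zero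
    refine le_trans (le_of_eq ?_) zero_le
    rw [← ae_iff]
    filter_upwards [h0] with ω hω
    have h2 : ∀ i : Fin n, η i ω = 0 := fun i => hω i i.2
    simp [energy, h2]
  · have h1 := lintegral_exp_energy_le hk hlam hkm hsigma hmono hle n hη hηm hind hx
    set W : Ω → ℝ := fun ω => energy k lam (fun t => x t ω) (fun t => η t ω) n / (2 * sigma ^ 2)
      - (∑ i ∈ Finset.range n,
        Real.log (1 + lam⁻¹ * postVar k lam (fun t => x t ω) i (x i ω))) / 2 with hW
    have h2 : {ω | ¬ energy k lam (fun t => x t ω) (fun t => η t ω) n ≤ sigma ^ 2 *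
        (2 * Real.log (1 / delta) + ∑ i ∈ Finset.range n,
        Real.log (1 + lam⁻¹ * postVar k lam (fun t => x t ω) i (x i ω)))}
        ⊆ {ω | ENNReal.ofReal (1 / delta) ≤ ENNReal.ofReal (Real.exp (W ω))} := by
      intro ω hω
      simp only [Set.mem_ofPred_eq, not_le] at hω ⊢
      refine ENNReal.ofReal_le_ofReal ?_
      rw [← Real.log_le_iff_le_exp (by positivity), hW]
      have h3 : 2 * Real.log (1 / delta) + ∑ i ∈ Finset.range n,
        Real.log (1 + lam⁻¹ * postVar k lam (fun t => x t ω) i (x i ω))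
        < energy k lam (fun t => x t ω) (fun t => η t ω) n / sigma ^ 2 := by
        rw [lt_div_iff₀ (by positivity)]; linarith
      have h4 : energy k lam (fun t => x t ω) (fun t => η t ω) n / (2 * sigma ^ 2)
        = (energy k lam (fun t => x t ω) (fun t => η t ω) n / sigma ^ 2) / 2 := by
        field_simp
      simp only [h4]
      linarith
    refine (measure_mono h2).trans ?_
    have hWm : Measurable W := by
      have hx' : ∀ i < n, Measurable (x i) := fun i hi => (hx i hi).mono (hle _) le_rfl
      have hη' : ∀ i < n, Measurable (η i) := fun i hi => (hηm i hi).mono (hle _) le_rfl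
      refine ((measurable_energy hkm hx' hη').div_const _).sub
        ((Finset.measurable_sum _ fun i hi => ?_).div_const _)
      have hi := Finset.mem_range.1 hi
      exact Real.measurable_log.comp (((measurable_postVar hkm
        (fun j hj => hx' j (hj.trans hi)) (hx' i hi)).const_mul _).const_add _)
    -- Markov at one fixed time suffices, as confidence intervals are used only at the end of an
    -- episode.
    have h5 := meas_ge_le_lintegral_div (μ := P) (f := fun ω => ENNReal.ofReal (Real.exp (W ω)))
      (by fun_prop) (ε := ENNReal.ofReal (1 / delta)) (by simpa using hdelta)
      ENNReal.ofReal_ne_top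
    refine h5.trans ((ENNReal.div_le_div_right h1 _).trans ?_)
    rw [one_div, one_div, ENNReal.ofReal_inv_of_pos hdelta, inv_inv]

end Noise

/-! ### Elimination with intervals that are too narrow -/

section Elimination

variable {X : Type*} {m s F : X → ℝ} {beta r : ℝ} {S : Set X} {w : X}

/-- The test uses width β while the true error is β + r. In an elimination the β terms cancel, so a
wrongly removed action is better by the r terms only. -/
lemma retained_or_sub_le (h : ∀ z, |m z - F z| ≤ (beta + r) * s z) (z w : X) :
    m w - beta * s w ≤ m z + beta * s z ∨ F z - F w ≤ r * (s z + s w) := by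
  by_contra! hc
  have h1 := abs_le.1 (h z)
  have h2 := abs_le.1 (h w)
  linarith

/-- β is paid twice, for the error of the mean and for the overlap of the intervals. -/
lemma sub_le_of_retained (h : ∀ z, |m z - F z| ≤ (beta + r) * s z)
    (hw : IsMaxOn (fun z => m z - beta * s z) S w) {z u : X} (hz : z ∈ S)
    (hu : m w - beta * s w ≤ m u + beta * s u) :
    F z - F u ≤ (2 * beta + r) * (s z + s u) := by
  have h1 := abs_le.1 (h z)
  have h2 := abs_le.1 (h u)
  have h3 : m z - beta * s z ≤ m w - beta * s w := hw hz
  linarith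

end Elimination

/-! ### Regret on the event that the noise is controlled -/

section Deterministic

variable {X H : Type*} [NormedAddCommGroup H] [InnerProductSpace ℝ H]
  {φ : X → H} {k : X → X → ℝ} {lam sigma B epsilon delta : ℝ} {f : H} {fstar : X → ℝ}

/-- The noise of the first `n` rounds is within the self-normalized confidence bound. -/
def NoiseBounded (k : X → X → ℝ) (lam sigma delta : ℝ) (x : ℕ → X) (η : ℕ → ℝ) (n : ℕ) : Prop :=
  energy k lam x η n ≤ sigma ^ 2 * (2 * Real.log (1 / delta)
    + ∑ i ∈ Finset.range n, Real.log (1 + lam⁻¹ * postVar k lam x i (x i)))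

/-- The confidence bound of the realizable setting, enlarged by the misspecification. -/
lemma abs_postMean_sub_le (hk : ∀ z w, k z w = ⟪φ z, φ w⟫_ℝ) (hlam : 0 < lam)
    (hsigma : 0 ≤ sigma) (hepsilon : 0 ≤ epsilon) (hf : ‖f‖ ≤ B)
    (hfstar : ∀ z, |⟪f, φ z⟫_ℝ - fstar z| ≤ epsilon) {x : ℕ → X} {η : ℕ → ℝ} {n : ℕ}
    (hη : NoiseBounded k lam sigma delta x η n) (z : X) :
    |postMean k lam x (fun i => fstar (x i) + η i) n z - ⟪f, φ z⟫_ℝ|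
      ≤ (confBeta k lam sigma B delta x n + epsilon * Real.sqrt (n / lam))
        * postStd k lam x n z := by
  -- The posterior mean is linear in the observations: exact values of `f`, misspecification, noise.
  have h0 : postMean k lam x (fun i => fstar (x i) + η i) n z
      = postMean k lam x (fun i => ⟪f, φ (x i)⟫_ℝ) n z
        + (postMean k lam x (fun i => fstar (x i) - ⟪f, φ (x i)⟫_ℝ) n z
          + postMean k lam x η n z) := by
    rw [← postMean_add, ← postMean_add]
    congr 1
    ext i; ring
  have h1 := abs_postMean_inner_sub_le hk hlam x n z f
  have h2 := abs_postMean_le_of_bounded hk hlam x n z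
    (g := fun i => fstar (x i) - ⟪f, φ (x i)⟫_ℝ) hepsilon
    (fun i _ => by rw [abs_sub_comm]; exact hfstar _)
  have h3 : |postMean k lam x η n z| ≤ sigma / Real.sqrt lam *
    Real.sqrt (2 * Real.log (1 / delta)
      + ∑ i ∈ Finset.range n, Real.log (1 + lam⁻¹ * postVar k lam x i (x i)))
      * postStd k lam x n z := by
    rw [postStd, ← Real.sqrt_sq (show 0 ≤ sigma / Real.sqrt lam by positivity),
      ← Real.sqrt_mul (sq_nonneg _), mul_comm, ← Real.sqrt_mul (postVar_nonneg hk hlam _ _ _)]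
    refine Real.abs_le_sqrt ((sq_postMean_le hk hlam x η n z).trans ?_)
    refine mul_le_mul_of_nonneg_left ?_ (postVar_nonneg hk hlam _ _ _)
    rw [div_pow, Real.sq_sqrt hlam.le, div_eq_inv_mul, mul_assoc]
    exact mul_le_mul_of_nonneg_left hη (by positivity)
  have h4 : ‖f‖ * postStd k lam x n z ≤ B * postStd k lam x n z :=
    mul_le_mul_of_nonneg_right hf (Real.sqrt_nonneg _)
  rw [h0, confBeta]
  rw [abs_le] at h1 h2 h3 ⊢
  constructor <;> linarith

lemma confBeta_nonneg (hlam : 0 < lam) (hsigma : 0 ≤ sigma) (hB : 0 ≤ B) (x : ℕ → X) (n : ℕ) :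
    0 ≤ confBeta k lam sigma B delta x n := by
  unfold confBeta; positivity

lemma confBeta_le [Nonempty X] (hk : ∀ z w, k z w = ⟪φ z, φ w⟫_ℝ) (hlam : 0 < lam)
    (hk1 : ∀ z, k z z ≤ 1) (hsigma : 0 ≤ sigma) (x : ℕ → X) {n N : ℕ} (hn : n ≤ N) :
    confBeta k lam sigma B delta x n ≤ sigma / Real.sqrt lam *
      Real.sqrt (2 * Real.log (1 / delta) + 2 * infoGain k lam N) + B := by
  have h1 := sum_log_le_infoGain hk hlam hk1 x n
  have h2 := infoGain_mono hk hlam hk1 hn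
  unfold confBeta
  gcongr
  linarith

lemma postStd_le_of_isMaxOn [Nonempty X] (hk : ∀ z w, k z w = ⟪φ z, φ w⟫_ℝ) (hlam : 0 < lam)
    (hk1 : ∀ z, k z z ≤ 1) {S : Set X} {x : ℕ → X} {n : ℕ} (hn : 0 < n)
    (hx : ∀ i < n, IsMaxOn (postVar k lam x i) S (x i)) {z : X} (hz : z ∈ S) :
    postStd k lam x n z ≤ Real.sqrt (lam / n) * Real.sqrt ((2 + lam⁻¹) * infoGain k lam n) := by
  have hn' : (0 : ℝ) < n := by exact_mod_cast hn
  rw [← Real.sqrt_mul (by positivity)]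
  refine Real.sqrt_le_sqrt ?_
  have := mul_postVar_le_of_isMaxOn hk hlam hk1 hx hz
  rw [div_mul_eq_mul_div, le_div_iff₀ hn']
  linarith

variable {x : ℕ → X} {η : ℕ → ℝ} {T : ℕ}

lemma isMaxOn_of_isRun {y : ℕ → ℝ} (hrun : IsRun k lam sigma B delta T x y) {e : ℕ}
    (he : 2 ^ (e + 1) - 1 < T) :
    ∀ i < 2 ^ e, IsMaxOn (postVar k lam (episode x e) i) (active k lam sigma B delta x y e)
      (episode x e i) := fun i hi => by
  refine (hrun e i hi ?_).2
  have : 2 ^ (e + 1) = 2 ^ e + 2 ^ e := by rw [pow_succ]; ring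
  omega

/-- Nonemptiness also yields the attained maximum of `lcb`, which membership in the next active set
asserts. -/
lemma active_succ_nonempty {y : ℕ → ℝ} (hrun : IsRun k lam sigma B delta T x y) {e : ℕ}
    (he : 2 ^ (e + 1) - 1 < T) : (active k lam sigma B delta x y (e + 1)).Nonempty :=
  ⟨_, (hrun (e + 1) 0 (by positivity) he).1⟩

/-- A near-optimal action survives the elimination step. -/
lemma exists_active_succ_sub_le [Nonempty X] (hk : ∀ z w, k z w = ⟪φ z, φ w⟫_ℝ) (hlam : 0 < lam)
    (hk1 : ∀ z, k z z ≤ 1) (hsigma : 0 ≤ sigma) (hB : 0 ≤ B) (hepsilon : 0 ≤ epsilon)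
    (hf : ‖f‖ ≤ B) (hfstar : ∀ z, |⟪f, φ z⟫_ℝ - fstar z| ≤ epsilon)
    (hrun : IsRun k lam sigma B delta T x (fun t => fstar (x t) + η t)) {e : ℕ}
    (he : 2 ^ (e + 1) - 1 < T)
    (hη : NoiseBounded k lam sigma delta (episode x e) (episode η e) (2 ^ e)) {z : X}
    (hz : z ∈ active k lam sigma B delta x (fun t => fstar (x t) + η t) e) :
    ∃ w ∈ active k lam sigma B delta x (fun t => fstar (x t) + η t) (e + 1),
      ⟪f, φ z⟫_ℝ - ⟪f, φ w⟫_ℝ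
        ≤ 2 * epsilon * Real.sqrt ((2 + lam⁻¹) * infoGain k lam (2 ^ e)) := by
  obtain ⟨u, hu, w, hw, hmax, -⟩ := active_succ_nonempty hrun he
  have hconf := abs_postMean_sub_le hk hlam hsigma hepsilon hf hfstar hη
  have hstd := fun {z} => postStd_le_of_isMaxOn (z := z) hk hlam hk1
    (Nat.two_pow_pos e) (isMaxOn_of_isRun hrun he)
  rcases retained_or_sub_le hconf z w with h | h
  · refine ⟨z, ⟨hz, w, hw, hmax, h⟩, ?_⟩
    rw [sub_self]; positivity
  · have hwu : w ∈ active k lam sigma B delta x (fun t => fstar (x t) + η t) (e + 1) := by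
      refine ⟨hw, w, hw, hmax, ?_⟩
      have h1 := confBeta_nonneg (k := k) (delta := delta) hlam hsigma hB (episode x e) (2 ^ e)
      have h2 : 0 ≤ postStd k lam (episode x e) (2 ^ e) w := Real.sqrt_nonneg _
      have h3 := mul_nonneg h1 h2
      simp only [lcb, ucb]
      linarith
    refine ⟨w, hwu, h.trans ?_⟩
    have hn : (0 : ℝ) < (2 ^ e : ℕ) := by positivity
    -- The misspecification width grows like √(n/λ) while the deviation shrinks like √(λ/n): the
    -- loss does not grow with the episode.
    have hcancel : Real.sqrt ((2 ^ e : ℕ) / lam) * Real.sqrt (lam / (2 ^ e : ℕ)) = 1 := by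
      rw [← Real.sqrt_mul (by positivity), div_mul_div_cancel₀ hlam.ne', div_self hn.ne',
        Real.sqrt_one]
    have h5 := add_le_add (hstd hz) (hstd hw)
    calc _ ≤ epsilon * Real.sqrt ((2 ^ e : ℕ) / lam) * _ :=
          mul_le_mul_of_nonneg_left h5 (by positivity)
      _ = 2 * epsilon * (Real.sqrt ((2 ^ e : ℕ) / lam) * Real.sqrt (lam / (2 ^ e : ℕ)))
          * Real.sqrt ((2 + lam⁻¹) * infoGain k lam (2 ^ e)) := by ring
      _ = _ := by rw [hcancel, mul_one]

/-- Any two actions that survive an elimination step have close values. -/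
lemma sub_le_of_mem_active_succ [Nonempty X] (hk : ∀ z w, k z w = ⟪φ z, φ w⟫_ℝ) (hlam : 0 < lam)
    (hk1 : ∀ z, k z z ≤ 1) (hsigma : 0 ≤ sigma) (hB : 0 ≤ B) (hepsilon : 0 ≤ epsilon)
    (hf : ‖f‖ ≤ B) (hfstar : ∀ z, |⟪f, φ z⟫_ℝ - fstar z| ≤ epsilon)
    (hrun : IsRun k lam sigma B delta T x (fun t => fstar (x t) + η t)) {e : ℕ}
    (he : 2 ^ (e + 1) - 1 < T)
    (hη : NoiseBounded k lam sigma delta (episode x e) (episode η e) (2 ^ e)) {z u : X}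
    (hz : z ∈ active k lam sigma B delta x (fun t => fstar (x t) + η t) (e + 1))
    (hu : u ∈ active k lam sigma B delta x (fun t => fstar (x t) + η t) (e + 1)) :
    ⟪f, φ z⟫_ℝ - ⟪f, φ u⟫_ℝ
      ≤ 4 * confBeta k lam sigma B delta (episode x e) (2 ^ e) * (Real.sqrt (lam / (2 ^ e : ℕ))
          * Real.sqrt ((2 + lam⁻¹) * infoGain k lam (2 ^ e)))
        + 2 * epsilon * Real.sqrt ((2 + lam⁻¹) * infoGain k lam (2 ^ e)) := by
  obtain ⟨hu', w, hw, hmax, hret⟩ := hu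
  have hconf := abs_postMean_sub_le hk hlam hsigma hepsilon hf hfstar hη
  have hstd := fun {z} => postStd_le_of_isMaxOn (z := z) hk hlam hk1
    (Nat.two_pow_pos e) (isMaxOn_of_isRun hrun he)
  refine (sub_le_of_retained hconf hmax hz.1 hret).trans ?_
  have hn : (0 : ℝ) < (2 ^ e : ℕ) := by positivity
  have hcancel : Real.sqrt ((2 ^ e : ℕ) / lam) * Real.sqrt (lam / (2 ^ e : ℕ)) = 1 := by
    rw [← Real.sqrt_mul (by positivity), div_mul_div_cancel₀ hlam.ne', div_self hn.ne',
      Real.sqrt_one]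
  have hbeta := confBeta_nonneg (k := k) (delta := delta) hlam hsigma hB (episode x e) (2 ^ e)
  have h5 := add_le_add (hstd hz.1) (hstd hu')
  refine (mul_le_mul_of_nonneg_left h5 (by positivity)).trans (le_of_eq ?_)
  set R := Real.sqrt ((2 + lam⁻¹) * infoGain k lam (2 ^ e))
  set b := confBeta k lam sigma B delta (episode x e) (2 ^ e)
  set p := Real.sqrt (lam / (2 ^ e : ℕ))
  set q := Real.sqrt ((2 ^ e : ℕ) / lam)
  calc (2 * b + epsilon * q) * (p * R + p * R) = 4 * b * (p * R) + 2 * epsilon * (q * p) * R := by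
        ring
    _ = _ := by rw [hcancel, mul_one]

/-- The losses of successive eliminations add, each bounded through the monotonicity of the
information gain. -/
lemma exists_active_sub_le [Nonempty X] (hk : ∀ z w, k z w = ⟪φ z, φ w⟫_ℝ) (hlam : 0 < lam)
    (hk1 : ∀ z, k z z ≤ 1) (hsigma : 0 ≤ sigma) (hB : 0 ≤ B) (hepsilon : 0 ≤ epsilon)
    (hf : ‖f‖ ≤ B) (hfstar : ∀ z, |⟪f, φ z⟫_ℝ - fstar z| ≤ epsilon)
    (hrun : IsRun k lam sigma B delta T x (fun t => fstar (x t) + η t))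
    (hη : ∀ e, 2 ^ (e + 1) - 1 < T →
      NoiseBounded k lam sigma delta (episode x e) (episode η e) (2 ^ e)) (z : X) (e : ℕ)
    (he : 2 ^ e - 1 < T) :
    ∃ w ∈ active k lam sigma B delta x (fun t => fstar (x t) + η t) e,
      ⟪f, φ z⟫_ℝ - ⟪f, φ w⟫_ℝ
        ≤ e * (2 * epsilon * Real.sqrt ((2 + lam⁻¹) * infoGain k lam T)) := by
  induction e with
  | zero => exact ⟨z, Set.mem_univ z, by simp⟩
  | succ e ih =>
    have h2 : 2 ^ (e + 1) = 2 ^ e + 2 ^ e := by rw [pow_succ]; ring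
    have h3 := Nat.two_pow_pos e
    obtain ⟨w, hw, hzw⟩ := ih (by omega)
    obtain ⟨u, hu, hwu⟩ := exists_active_succ_sub_le hk hlam hk1 hsigma hB hepsilon hf hfstar
      hrun he (hη e he) hw
    refine ⟨u, hu, ?_⟩
    have h4 : Real.sqrt ((2 + lam⁻¹) * infoGain k lam (2 ^ e))
        ≤ Real.sqrt ((2 + lam⁻¹) * infoGain k lam T) := by
      have := infoGain_mono hk hlam hk1 (show 2 ^ e ≤ T by omega)
      gcongr
    have h5 := mul_le_mul_of_nonneg_left h4 (by positivity : 0 ≤ 2 * epsilon)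
    push_cast
    linarith

/-- The regret of a single round. -/
lemma round_regret_le [Nonempty X] (hk : ∀ z w, k z w = ⟪φ z, φ w⟫_ℝ) (hlam : 0 < lam)
    (hk1 : ∀ z, k z z ≤ 1) (hsigma : 0 ≤ sigma) (hB : 0 ≤ B) (hepsilon : 0 ≤ epsilon)
    (hf : ‖f‖ ≤ B) (hfstar : ∀ z, |⟪f, φ z⟫_ℝ - fstar z| ≤ epsilon)
    (hrun : IsRun k lam sigma B delta T x (fun t => fstar (x t) + η t))
    (hη : ∀ e, 2 ^ (e + 1) - 1 < T →
      NoiseBounded k lam sigma delta (episode x e) (episode η e) (2 ^ e)) (z : X) {t : ℕ}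
    (ht : t < T) :
    fstar z - fstar (x t) ≤ 8 * (sigma / Real.sqrt lam *
        Real.sqrt (2 * Real.log (1 / delta) + 2 * infoGain k lam T) + B)
        * (Real.sqrt lam * Real.sqrt ((2 + lam⁻¹) * infoGain k lam T)) * (Real.sqrt (t + 1))⁻¹
      + (Nat.log 2 T + 1) * (2 * epsilon * Real.sqrt ((2 + lam⁻¹) * infoGain k lam T))
      + 2 * epsilon + if t = 0 then 2 * B else 0 := by
  have hz1 := abs_le.1 (hfstar z)
  have hz2 := abs_le.1 (hfstar (x t))
  set R := Real.sqrt ((2 + lam⁻¹) * infoGain k lam T) with hR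
  set b := sigma / Real.sqrt lam *
        Real.sqrt (2 * Real.log (1 / delta) + 2 * infoGain k lam T) + B with hb
  have hR0 : 0 ≤ R := Real.sqrt_nonneg _
  have hb0 : 0 ≤ b := by positivity
  -- Round 0 is all of episode 0 and has no data behind it; the range of `f` gives 2B.
  rcases Nat.eq_zero_or_pos t with rfl | htpos
  · have hφ : ∀ z, |⟪f, φ z⟫_ℝ| ≤ B := fun z => by
      refine (abs_real_inner_le_norm _ _).trans ?_
      have : ‖φ z‖ ≤ 1 := by
        have h1 := hk1 z
        rw [hk, real_inner_self_eq_norm_sq] at h1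
        exact (sq_le_one_iff₀ (norm_nonneg _)).1 h1
      calc ‖f‖ * ‖φ z‖ ≤ ‖f‖ * 1 := by gcongr
        _ ≤ B := by linarith
    have h1 := abs_le.1 (hφ z)
    have h2 := abs_le.1 (hφ (x 0))
    have h3 : 0 ≤ 8 * b * (Real.sqrt lam * R) * (Real.sqrt ((0 : ℕ) + 1))⁻¹
      + (Nat.log 2 T + 1) * (2 * epsilon * R) := by positivity
    simp only [if_true]
    linarith
  -- Round t ≥ 1 lies in an episode e + 1, whose active set was determined by the data of episode e.
  · obtain ⟨e, he⟩ : ∃ e, Nat.log 2 (t + 1) = e + 1 :=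
      Nat.exists_eq_succ_of_ne_zero (Nat.log_pos one_lt_two (by omega)).ne'
    have hlo : 2 ^ (e + 1) ≤ t + 1 := by rw [← he]; exact Nat.pow_log_le_self 2 (by omega)
    have hhi : t + 1 < 2 ^ (e + 1 + 1) := by
      rw [← he]; exact Nat.lt_pow_succ_log_self one_lt_two _
    have hlog : e + 1 ≤ Nat.log 2 T := by rw [← he]; exact Nat.log_mono_right ht
    have heT : 2 ^ (e + 1) - 1 < T := by omega
    have h2 : 2 ^ (e + 1) = 2 ^ e + 2 ^ e := by rw [pow_succ]; ring
    have h2' : 2 ^ (e + 1 + 1) = 2 ^ (e + 1) + 2 ^ (e + 1) := by rw [pow_succ]; ring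
    have hxt : episode x (e + 1) (t + 1 - 2 ^ (e + 1)) = x t := by
      unfold episode; congr 1; have := Nat.two_pow_pos e; omega
    have hmem := (hrun (e + 1) (t + 1 - 2 ^ (e + 1)) (by omega)
      (by have := Nat.two_pow_pos e; omega)).1
    rw [hxt] at hmem
    obtain ⟨w, hw, hzw⟩ := exists_active_sub_le hk hlam hk1 hsigma hB hepsilon hf hfstar
      hrun hη z (e + 1) heT
    have hwx := sub_le_of_mem_active_succ hk hlam hk1 hsigma hB hepsilon hf hfstar
      hrun heT (hη e heT) hw hmem
    have heT' : 2 ^ e ≤ T := by omega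
    have hRe : Real.sqrt ((2 + lam⁻¹) * infoGain k lam (2 ^ e)) ≤ R := by
      have := infoGain_mono hk hlam hk1 heT'
      rw [hR]; gcongr
    have hbe : confBeta k lam sigma B delta (episode x e) (2 ^ e) ≤ b :=
      confBeta_le hk hlam hk1 hsigma _ heT'
    -- Doubling lengths give t + 1 ≤ 4 · 2^e, so using the previous episode costs a factor 2.
    have hse : Real.sqrt (lam / (2 ^ e : ℕ)) ≤ 2 * (Real.sqrt lam * (Real.sqrt (t + 1))⁻¹) := by
      rw [← Real.sqrt_inv, ← Real.sqrt_mul hlam.le, ← Real.sqrt_sq zero_le_two,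
        ← Real.sqrt_mul (by positivity)]
      refine Real.sqrt_le_sqrt ?_
      have h4 : ((t : ℝ) + 1) ≤ 4 * (2 ^ e : ℕ) := by
        have : t + 1 ≤ 4 * 2 ^ e := by omega
        exact_mod_cast this
      have hn : (0 : ℝ) < (2 ^ e : ℕ) := by positivity
      have ht1 : (0 : ℝ) < t + 1 := by positivity
      rw [← div_eq_mul_inv, ← mul_div_assoc, div_le_div_iff₀ hn ht1]
      have := mul_le_mul_of_nonneg_left h4 hlam.le
      linarith
    have h5 : 4 * confBeta k lam sigma B delta (episode x e) (2 ^ e)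
        * (Real.sqrt (lam / (2 ^ e : ℕ))
          * Real.sqrt ((2 + lam⁻¹) * infoGain k lam (2 ^ e)))
        ≤ 4 * b * (2 * (Real.sqrt lam * (Real.sqrt (t + 1))⁻¹) * R) := by
      gcongr
    have h6 : 2 * epsilon * Real.sqrt ((2 + lam⁻¹) * infoGain k lam (2 ^ e))
        ≤ 2 * epsilon * R := by gcongr
    -- The e + 1 eliminations cost at most log₂ T units; comparing two survivors costs one more.
    have h7 : ((e + 1 : ℕ) : ℝ) * (2 * epsilon * R) ≤ Nat.log 2 T * (2 * epsilon * R) := by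
      gcongr
    rw [if_neg htpos.ne']
    linarith

/-- Telescoping of 1/√(n + 1) ≤ 2(√(n + 1) - √n). -/
lemma sum_inv_sqrt_le (n : ℕ) :
    ∑ t ∈ Finset.range n, (Real.sqrt ((t : ℝ) + 1))⁻¹ ≤ 2 * Real.sqrt n := by
  induction n with
  | zero => simp
  | succ n ih =>
    rw [Finset.sum_range_succ]
    push_cast
    have ha : 0 ≤ Real.sqrt (n : ℝ) := Real.sqrt_nonneg _
    have hb : 0 < Real.sqrt ((n : ℝ) + 1) := by positivity
    have ha2 : Real.sqrt (n : ℝ) ^ 2 = n := Real.sq_sqrt (by positivity)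
    have hb2 : Real.sqrt ((n : ℝ) + 1) ^ 2 = n + 1 := Real.sq_sqrt (by positivity)
    set a := Real.sqrt (n : ℝ)
    set b := Real.sqrt ((n : ℝ) + 1)
    have : b⁻¹ ≤ 2 * (b - a) := by
      rw [inv_le_iff_one_le_mul₀ hb]
      nlinarith [sq_nonneg (b - a)]
    linarith

lemma regret_le [Nonempty X] (hk : ∀ z w, k z w = ⟪φ z, φ w⟫_ℝ) (hlam : 0 < lam)
    (hk1 : ∀ z, k z z ≤ 1) (hsigma : 0 ≤ sigma) (hB : 0 ≤ B) (hepsilon : 0 ≤ epsilon)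
    (hf : ‖f‖ ≤ B) (hfstar : ∀ z, |⟪f, φ z⟫_ℝ - fstar z| ≤ epsilon) (hT : 1 ≤ T)
    (hrun : IsRun k lam sigma B delta T x (fun t => fstar (x t) + η t))
    (hη : ∀ e, 2 ^ (e + 1) - 1 < T →
      NoiseBounded k lam sigma delta (episode x e) (episode η e) (2 ^ e)) :
    regret fstar T x ≤ 8 * (sigma / Real.sqrt lam *
        Real.sqrt (2 * Real.log (1 / delta) + 2 * infoGain k lam T) + B)
        * (Real.sqrt lam * Real.sqrt ((2 + lam⁻¹) * infoGain k lam T)) * (2 * Real.sqrt T)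
      + T * ((Nat.log 2 T + 1) * (2 * epsilon * Real.sqrt ((2 + lam⁻¹) * infoGain k lam T))
      + 2 * epsilon) + 2 * B := by
  have h1 : ∀ t ∈ Finset.range T, (⨆ z, fstar z) - fstar (x t) ≤ 8 * (sigma / Real.sqrt lam *
        Real.sqrt (2 * Real.log (1 / delta) + 2 * infoGain k lam T) + B)
        * (Real.sqrt lam * Real.sqrt ((2 + lam⁻¹) * infoGain k lam T)) * (Real.sqrt (t + 1))⁻¹
      + ((Nat.log 2 T + 1) * (2 * epsilon * Real.sqrt ((2 + lam⁻¹) * infoGain k lam T))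
      + 2 * epsilon) + if t = 0 then 2 * B else 0 := by
    intro t ht
    rw [sub_le_iff_le_add]
    refine ciSup_le fun z => ?_
    have := round_regret_le hk hlam hk1 hsigma hB hepsilon hf hfstar hrun hη z
      (Finset.mem_range.1 ht)
    linarith
  refine (Finset.sum_le_sum h1).trans ?_
  rw [Finset.sum_add_distrib, Finset.sum_add_distrib, ← Finset.mul_sum, Finset.sum_const,
    Finset.card_range, nsmul_eq_mul, Finset.sum_ite_eq' (Finset.range T) 0 (fun _ => 2 * B),
    if_pos (Finset.mem_range.2 (by omega))]
  gcongr
  exact sum_inv_sqrt_le T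

end Deterministic

/-! ### Collecting the constants -/

/-- The regret bound with the polylogarithmic factors collected. -/
lemma regret_bound_le {lam sigma c B epsilon delta g : ℝ} (hlam : 0 < lam) (hsigma : 0 ≤ sigma)
    (hc : 0 < c) (hcg : c ≤ g) (hB : 0 < B) (hepsilon : 0 ≤ epsilon) (hdelta : 0 < delta)
    (hdelta1 : delta < 1) {T : ℕ} (hT : 1 ≤ T) :
    8 * (sigma / Real.sqrt lam *
        Real.sqrt (2 * Real.log (1 / (delta / numEpisodes T)) + 2 * g) + B)
        * (Real.sqrt lam * Real.sqrt ((2 + lam⁻¹) * g)) * (2 * Real.sqrt T)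
      + T * ((Nat.log 2 T + 1) * (2 * epsilon * Real.sqrt ((2 + lam⁻¹) * g))
      + 2 * epsilon) + 2 * B
    ≤ (16 * Real.sqrt lam * Real.sqrt (2 + lam⁻¹)
          * (sigma / Real.sqrt lam * Real.sqrt (2 + 4 / c) + 1)
        + 4 * Real.sqrt (2 + lam⁻¹) + 2 / Real.sqrt c) * (1 + Real.log T) ^ 1
      * (B * Real.sqrt (g * T) + Real.sqrt ((Real.log (1 / delta) + g) * g * T)
        + epsilon * T * Real.sqrt g) := by
  have hg : 0 < g := hc.trans_le hcg
  have hT' : (1 : ℝ) ≤ T := by exact_mod_cast hT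
  have hlogT : 0 ≤ Real.log T := Real.log_nonneg hT'
  have hl : 0 ≤ Real.log (1 / delta) := Real.log_nonneg (by rw [le_div_iff₀ hdelta]; linarith)
  set L := 1 + Real.log T with hL
  have hL1 : 1 ≤ L := by linarith
  have hE : (Nat.log 2 T : ℝ) + 1 ≤ 2 * L := by
    have h1 : (Nat.log 2 T : ℝ) * Real.log 2 ≤ Real.log T := by
      rw [← Real.log_pow]
      refine Real.log_le_log (by positivity) ?_
      exact_mod_cast Nat.pow_log_le_self 2 (by omega)
    have h2 := Real.log_two_gt_d9
    have h3 : (Nat.log 2 T : ℝ) * (1 / 2) ≤ Nat.log 2 T * Real.log 2 := by gcongr; linarith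
    linarith
  -- The crude log E ≤ E - 1 is affordable, since a power of 1 + ln T is allowed.
  have hlogE : Real.log (1 / (delta / numEpisodes T)) ≤ Real.log (1 / delta) + 2 * L := by
    have hE0 : (0 : ℝ) < numEpisodes T := by simp [numEpisodes]; positivity
    rw [one_div_div, Real.log_div hE0.ne' hdelta.ne', one_div, Real.log_inv]
    have h1 := Real.log_le_sub_one_of_pos hE0
    have h2 : (numEpisodes T : ℝ) = Nat.log 2 T + 1 := by simp [numEpisodes]
    linarith
  set l := Real.log (1 / delta) with hldef
  have hsq : Real.sqrt (2 * Real.log (1 / (delta / numEpisodes T)) + 2 * g)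
      ≤ Real.sqrt (2 + 4 / c) * L * Real.sqrt (l + g) := by
    have h1 : 2 * Real.log (1 / (delta / numEpisodes T)) + 2 * g
        ≤ (2 + 4 / c) * L ^ 2 * (l + g) := by
      -- `c ≤ g` trades the additive log E term for a multiple of `l + g`.
      have h2 : 1 ≤ (l + g) / c := by rw [le_div_iff₀ hc]; linarith
      have h3 : 4 * L ≤ 4 * L * ((l + g) / c) := le_mul_of_one_le_right (by positivity) h2
      have h4 : l + g ≤ L * (l + g) := le_mul_of_one_le_left (by positivity) hL1
      have h5 : L ≤ L ^ 2 := by nlinarith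
      calc _ ≤ (2 + 4 / c) * L * (l + g) := by
            have : (2 + 4 / c) * L * (l + g) = 2 * (L * (l + g)) + 4 * L * ((l + g) / c) := by
              ring
            linarith
        _ ≤ _ := by gcongr
    refine (Real.sqrt_le_sqrt h1).trans (le_of_eq ?_)
    rw [Real.sqrt_mul (by positivity), Real.sqrt_mul (by positivity), Real.sqrt_sq (by linarith)]
  have hgc : 1 ≤ Real.sqrt g / Real.sqrt c := by
    rw [le_div_iff₀ (by positivity), one_mul]; exact Real.sqrt_le_sqrt hcg
  have hsT : 1 ≤ Real.sqrt T := Real.one_le_sqrt.2 hT'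
  rw [Real.sqrt_mul (by positivity : 0 ≤ 2 + lam⁻¹), Real.sqrt_mul hg.le,
    Real.sqrt_mul (by positivity), Real.sqrt_mul (by positivity), pow_one]
  have hΛ0 : 0 ≤ Real.sqrt lam := Real.sqrt_nonneg _
  have hM0 : 0 ≤ Real.sqrt (2 + lam⁻¹) := Real.sqrt_nonneg _
  have hA0 : 0 ≤ Real.sqrt (2 + 4 / c) := Real.sqrt_nonneg _
  have hQ0 : 0 ≤ Real.sqrt (l + g) := Real.sqrt_nonneg _
  have hs0 : 0 ≤ sigma / Real.sqrt lam := by positivity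
  have hG0 : 0 ≤ Real.sqrt g := Real.sqrt_nonneg _
  have hD0 : 0 ≤ 2 / Real.sqrt c := by positivity
  -- Lets the terms without γ, namely 2B and 2εT, gain a factor √g.
  have hD : 2 ≤ 2 / Real.sqrt c * Real.sqrt g := by
    have : 2 / Real.sqrt c * Real.sqrt g = 2 * (Real.sqrt g / Real.sqrt c) := by ring
    rw [this]; linarith
  have hsT0 : 0 ≤ Real.sqrt T := Real.sqrt_nonneg _
  generalize Real.sqrt (2 * Real.log (1 / (delta / numEpisodes T)) + 2 * g) = r at hsq ⊢
  generalize (Nat.log 2 T : ℝ) = N at hE ⊢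
  generalize Real.sqrt (2 + 4 / c) = A at *
  generalize Real.sqrt (2 + lam⁻¹) = M at *
  generalize sigma / Real.sqrt lam = s at *
  generalize Real.sqrt lam = Λ at *
  generalize 2 / Real.sqrt c = D at *
  generalize Real.sqrt (l + g) = Q at *
  generalize Real.sqrt g = G at *
  generalize Real.sqrt (T : ℝ) = τ at *
  generalize (T : ℝ) = t at *
  have hL0 : 0 ≤ L := by linarith
  have ht0 : 0 ≤ t := by linarith
  have e1 : 8 * (s * r + B) * (Λ * (M * G)) * (2 * τ)
      ≤ 16 * Λ * M * (s * A + 1) * L * (B * (G * τ) + Q * G * τ) := by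
    calc _ ≤ 8 * (s * (A * L * Q) + L * B) * (Λ * (M * G)) * (2 * τ) := by
          gcongr
          exact le_mul_of_one_le_left hB.le hL1
      _ = 16 * Λ * M * L * (s * A * (Q * G * τ) + 1 * (B * (G * τ))) := by ring
      _ ≤ 16 * Λ * M * L * ((s * A + 1) * (Q * G * τ) + (s * A + 1) * (B * (G * τ))) := by
          have : 0 ≤ s * A := by positivity
          gcongr <;> linarith
      _ = _ := by ring
  have e2 : t * ((N + 1) * (2 * epsilon * (M * G))) ≤ 4 * M * L * (epsilon * t * G) := by
    calc _ ≤ t * ((2 * L) * (2 * epsilon * (M * G))) := by gcongr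
      _ = _ := by ring
  have e3 : t * (2 * epsilon) ≤ D * L * (epsilon * t * G) := by
    calc _ = 2 * (t * epsilon) := by ring
      _ ≤ (D * G) * (t * epsilon) := by gcongr
      _ ≤ L * ((D * G) * (t * epsilon)) := le_mul_of_one_le_left (by positivity) hL1
      _ = _ := by ring
  have e4 : 2 * B ≤ D * L * (B * (G * τ)) := by
    calc 2 * B ≤ (D * G) * B := by gcongr
      _ ≤ L * ((D * G) * B) := le_mul_of_one_le_left (by positivity) hL1
      _ ≤ (L * ((D * G) * B)) * τ := le_mul_of_one_le_right (by positivity) hsT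
      _ = _ := by ring
  -- What remains of the expanded right side after `e1` to `e4` is nonnegative.
  have e5 : 0 ≤ 16 * Λ * M * (s * A + 1) * L * (epsilon * t * G) := by positivity
  have e6 : 0 ≤ 4 * M * L * (B * (G * τ) + Q * G * τ) := by positivity
  have e7 : 0 ≤ D * L * (Q * G * τ) := by positivity
  linarith

/-! ### Union bound over episodes and conclusion -/

lemma two_pow_succ_sub_one_lt_iff {T e : ℕ} (hT : 1 ≤ T) :
    2 ^ (e + 1) - 1 < T ↔ e < Nat.log 2 T := by
  rw [← Nat.add_one_le_iff (n := e), Nat.le_log_iff_pow_le one_lt_two (by omega)]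
  have := Nat.two_pow_pos (e + 1)
  omega

/-- With high probability the noise of every completed episode is within its confidence bound. -/
lemma measure_not_forall_noiseBounded_le {Ω X H : Type*} [NormedAddCommGroup H]
    [InnerProductSpace ℝ H] [MeasurableSpace X] {φ : X → H} {k : X → X → ℝ} {lam sigma delta : ℝ}
    {mΩ : MeasurableSpace Ω} {P : Measure Ω} [IsProbabilityMeasure P] {ℱ : Filtration ℕ mΩ}
    {η : ℕ → Ω → ℝ} {x : ℕ → Ω → X} {T : ℕ} (hT : 1 ≤ T)
    (hk : ∀ z w, k z w = ⟪φ z, φ w⟫_ℝ) (hlam : 0 < lam)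
    (hkm : Measurable fun q : X × X => k q.1 q.2) (hsigma : 0 ≤ sigma) (hdelta : 0 < delta)
    (hη : ∀ t < T, HasSubgaussianMGF (η t) (Real.toNNReal (sigma ^ 2)) P)
    (hηm : ∀ t < T, Measurable[ℱ (t + 1)] (η t))
    (hind : ∀ t < T, Indep (MeasurableSpace.comap (η t) inferInstance) (ℱ t) P)
    (hx : ∀ t < T, Measurable[ℱ t] (x t)) :
    P {ω | ¬ ∀ e, 2 ^ (e + 1) - 1 < T → NoiseBounded k lam sigma (delta / numEpisodes T)
      (episode (fun t => x t ω) e) (episode (fun t => η t ω) e) (2 ^ e)}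
      ≤ ENNReal.ofReal delta := by
  have hE : (0 : ℝ) < numEpisodes T := by simp [numEpisodes]; positivity
  have hsub : {ω | ¬ ∀ e, 2 ^ (e + 1) - 1 < T → NoiseBounded k lam sigma (delta / numEpisodes T)
      (episode (fun t => x t ω) e) (episode (fun t => η t ω) e) (2 ^ e)}
      ⊆ ⋃ e ∈ Finset.range (Nat.log 2 T), {ω | ¬ NoiseBounded k lam sigma
        (delta / numEpisodes T) (episode (fun t => x t ω) e) (episode (fun t => η t ω) e)
        (2 ^ e)} := by
    intro ω hω
    simp only [Set.mem_ofPred_eq, not_forall] at hω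
    obtain ⟨e, he, h⟩ := hω
    simp only [Set.mem_iUnion]
    exact ⟨e, Finset.mem_range.2 ((two_pow_succ_sub_one_lt_iff hT).1 he), h⟩
  refine (measure_mono hsub).trans ((measure_biUnion_finset_le _ _).trans ?_)
  have hbound : ∀ e ∈ Finset.range (Nat.log 2 T), P {ω | ¬ NoiseBounded k lam sigma
      (delta / numEpisodes T) (episode (fun t => x t ω) e) (episode (fun t => η t ω) e) (2 ^ e)}
      ≤ ENNReal.ofReal (delta / numEpisodes T) := by
    intro e he
    have he := (two_pow_succ_sub_one_lt_iff hT).2 (Finset.mem_range.1 he)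
    have hlt : ∀ t < 2 ^ e, 2 ^ e - 1 + t < T := fun t ht => by
      have : 2 ^ (e + 1) = 2 ^ e + 2 ^ e := by rw [pow_succ]; ring
      omega
    -- The model is reset, so an episode is a fresh regression along the filtration shifted to its
    -- first round.
    exact measure_energy_gt_le (ℱ := fun t => ℱ (2 ^ e - 1 + t))
      (η := fun t => η (2 ^ e - 1 + t)) (x := fun t => x (2 ^ e - 1 + t)) hk hlam hkm hsigma
      (fun a b hab => ℱ.mono (Nat.add_le_add_left hab _)) (fun t => ℱ.le _) (2 ^ e)
      (fun t ht => hη _ (hlt t ht)) (fun t ht => hηm _ (hlt t ht))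
      (fun t ht => hind _ (hlt t ht)) (fun t ht => hx _ (hlt t ht)) (div_pos hdelta hE)
  -- Only log₂ T = E - 1 episodes precede another round, each failing with probability at most δ/E.
  refine (Finset.sum_le_sum hbound).trans ?_
  rw [Finset.sum_const, Finset.card_range, nsmul_eq_mul, ← ENNReal.ofReal_natCast,
    ← ENNReal.ofReal_mul (by positivity)]
  refine ENNReal.ofReal_le_ofReal ?_
  rw [← mul_div_assoc, div_le_iff₀ hE, mul_comm]
  gcongr
  simp [numEpisodes]

end PhasedGP

theorem mainTheorem2 :
    ∃ p : ℕ, ∀ (lam sigma kappa : ℝ), 0 < lam → 0 ≤ sigma → 0 < kappa →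
    ∃ C : ℝ, 0 < C ∧
    -- the action set, the kernel and its reproducing kernel Hilbert space
    ∀ (d : ℕ) (D : Set (EuclideanSpace ℝ (Fin d))), IsCompact D → D.Nonempty →
    ∀ (H : Type*) [NormedAddCommGroup H] [InnerProductSpace ℝ H] [CompleteSpace H]
      [RKHS ℝ H D ℝ] (k : D → D → ℝ),
      (∀ z w : D, RKHS.kernel H z w 1 = k z w) →
      Measurable (fun q : D × D => k q.1 q.2) →
      (∀ z : D, k z z ≤ 1) → (∃ z : D, kappa ≤ k z z) →
    -- the reward function and its approximation in the hypothesis class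
    ∀ (B epsilon : ℝ), 0 < B → 0 ≤ epsilon →
    ∀ (fstar : D → ℝ) (f : H), ‖f‖ ≤ B → (∀ z : D, |f z - fstar z| ≤ epsilon) →
    ∀ (delta : ℝ), 0 < delta → delta < 1 →
    ∀ (T : ℕ), 1 ≤ T →
    -- independent sub-Gaussian noise and non-anticipating actions
    ∀ (Ω : Type*) [mΩ : MeasurableSpace Ω] (P : Measure Ω) [IsProbabilityMeasure P]
      (ℱ : Filtration ℕ mΩ) (η : ℕ → Ω → ℝ) (x : ℕ → Ω → D),
      (∀ t < T, HasSubgaussianMGF (η t) (Real.toNNReal (sigma ^ 2)) P) →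
      (∀ t < T, Measurable[ℱ (t + 1)] (η t)) →
      (∀ t < T, Indep (MeasurableSpace.comap (η t) inferInstance) (ℱ t) P) →
      (∀ t < T, Measurable[ℱ t] (x t)) →
      -- the actions are those of the algorithm, with confidence bounds at level `δ / E`
      (∀ ω, PhasedGP.IsRun k lam sigma B (delta / PhasedGP.numEpisodes T) T
        (fun t => x t ω) (fun t => fstar (x t ω) + η t ω)) →
    P {ω | ¬ (
      PhasedGP.regret fstar T (fun t => x t ω)
        ≤ C * (1 + Real.log T) ^ p *
          (B * Real.sqrt (PhasedGP.infoGain k lam T * T)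
            + Real.sqrt ((Real.log (1 / delta) + PhasedGP.infoGain k lam T)
                * PhasedGP.infoGain k lam T * T)
            + epsilon * T * Real.sqrt (PhasedGP.infoGain k lam T)) ∧
      -- at each elimination step that precedes another round, a near-optimal action survives
      ∀ e : ℕ, 2 ^ (e + 1) - 1 < T →
        ∀ z ∈ PhasedGP.active k lam sigma B (delta / PhasedGP.numEpisodes T)
            (fun t => x t ω) (fun t => fstar (x t ω) + η t ω) e,
        ∃ w ∈ PhasedGP.active k lam sigma B (delta / PhasedGP.numEpisodes T)
            (fun t => x t ω) (fun t => fstar (x t ω) + η t ω) (e + 1),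
          f z - f w ≤
            2 * epsilon * Real.sqrt ((2 + lam⁻¹) * PhasedGP.infoGain k lam (2 ^ e)))}
      ≤ ENNReal.ofReal delta := by
  -- One power of 1 + ln T covers both the number of eliminations and the confidence level δ/E.
  refine ⟨1, fun lam sigma kappa hlam hsigma hkappa => ?_⟩
  set c := (1 / 2) * Real.log (1 + lam⁻¹ * kappa) with hc
  have hc0 : 0 < c := by
    have : 0 < lam⁻¹ * kappa := by positivity
    have := Real.log_pos (show 1 < 1 + lam⁻¹ * kappa by linarith)
    positivity
  refine ⟨16 * Real.sqrt lam * Real.sqrt (2 + lam⁻¹)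
      * (sigma / Real.sqrt lam * Real.sqrt (2 + 4 / c) + 1)
    + 4 * Real.sqrt (2 + lam⁻¹) + 2 / Real.sqrt c, by positivity, ?_⟩
  intro d D _ hD H _ _ _ _ k hker hkm hk1 ⟨z₀, hz₀⟩ B epsilon hB hepsilon fstar f hf hfstar
    delta hdelta hdelta1 T hT Ω mΩ P _ ℱ η x hη hηm hind hx hrun
  have : Nonempty D := ⟨z₀⟩
  -- The feature map is `RKHS.kerFun H z 1`, by the reproducing property.
  have heval : ∀ (g : H) (z : D), inner ℝ g (RKHS.kerFun H z (1 : ℝ)) = g z := fun g z => by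
    rw [RKHS.inner_kerFun]; simp
  have hk : ∀ z w : D, k z w
      = inner ℝ (RKHS.kerFun H z (1 : ℝ)) (RKHS.kerFun H w (1 : ℝ)) := fun z w => by
    rw [real_inner_comm, heval, RKHS.kerFun_apply, hker]
  have hfstar' : ∀ z : D, |inner ℝ f (RKHS.kerFun H z (1 : ℝ)) - fstar z| ≤ epsilon := fun z => by
    rw [heval]; exact hfstar z
  -- The failure event lies inside that of the noise bound; monotonicity of outer measure needs no
  -- measurability.
  refine (measure_mono fun ω hω => ?_).trans (PhasedGP.measure_not_forall_noiseBounded_le hT hk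
    hlam hkm hsigma hdelta hη hηm hind hx)
  simp only [Set.mem_ofPred_eq] at hω ⊢
  contrapose! hω
  refine ⟨(PhasedGP.regret_le hk hlam hk1 hsigma hB.le hepsilon hf hfstar' hT (hrun ω) hω).trans
    (PhasedGP.regret_bound_le hlam hsigma hc0
      (PhasedGP.le_infoGain_of_le_diag hk hlam hk1 hkappa hz₀ hT) hB hepsilon hdelta hdelta1 hT),
    fun e he z hz => ?_⟩
  obtain ⟨w, hw, hzw⟩ := PhasedGP.exists_active_succ_sub_le hk hlam hk1 hsigma hB.le hepsilon hf
    hfstar' (hrun ω) he (hω e he) hz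
  rw [heval, heval] at hzw
  exact ⟨w, hw, hzw⟩
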